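/- \textbf{Proposition.} Let $|x\rangle,|y\rangle$ be two quantum states of $n$ qubits, i.e. unit vectors of $(\mathbb C^2)^{\otimes n}$, that can be prepared in time $T_{\rm in}$: there are unitaries $U,V$ with $U|0^n\rangle=|x\rangle$, $V|0^n\rangle=|y\rangle$ such that each of the controlled operations $U^{\pm1},V^{\pm1}$ takes time $T_{\rm in}\ge\max(1,n)$. Let $f:\mathbb C\to\{0,1\}^b$ be any function and let $0<\epsilon\le 1$. Then there is a quantum algorithm that runs in time $O(T_{\rm in}/\epsilon)$ and achieves, to any prescribed accuracy $\delta>0$ and with probability at least $1-\delta$, \[ \frac{1}{\sqrt2}\bigl(|0\rangle|x\rangle+|1\rangle|y\rangle\bigr)\;\mapsto\;\frac{1}{\sqrt2}\bigl(|0\rangle|x\rangle+|1\rangle|y\rangle\bigr)\,|f(s)\rangle, \qquad |\langle x|y\rangle-s|\le\epsilon . \] Precisely: an algorithm is a circuit, fixed before $U,V,f$ are known, whose steps are (i) arbitrary unitaries on at most three qubits, of time $1$ each; (ii) controlled $U^{\pm1}$ and controlled $V^{\pm1}$, of time $T_{\rm in}$ each; (iii) reversible evaluations $|p\rangle|q\rangle|v\rangle\mapsto|p\rangle|q\rangle|v\oplus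 f(\alpha_p+\mathrm i\,\beta_q)\rangle$, where $p\in\{0,1\}^k$ and $q\in\{0,1\}^l$ index two fixed tables of real numbers $\alpha,\beta$, of time $2^k+2^l+1$ each (the length of the tables, plus one unit for the evaluation of $f$). For every $\delta>0$ there are a real $C>0$ and an integer $R\ge1$, depending only on $\delta$, such that for all $n,b\ge 0$ and $0<\epsilon\le1$ there are a number $w$ of work qubits and $R$ such circuits $c_1,\dots,c_R$ acting on $1+n+b+w$ qubits with the following two properties. (1) For every integer $T_{\rm in}\ge\max(1,n)$, each $c_r$ runs in time at most $C\,T_{\rm in}/\epsilon$. (2) For all $f:\mathbb C\to\{0,1\}^b$ and all $|x\rangle,|y\rangle,U,V$ as above, at least $(1-\delta)R$ of the indices $r\in\{1,\dots,R\}$ (that is, a uniformly random $r$ with probability at least $1-\delta$) have the property that there is $s\in\mathbb C$ with $|\langle x|y\rangle-s|\le\epsilon$ and \[ \Bigl\| c_r\Bigl(\tfrac{1}{\sqrt2}(|0\rangle|x\rangle+|1\rangle|y\rangle)\,|0^b\rangle|0^w\rangle\Bigr)-\tfrac{1}{\sqrt2}(|0\rangle|x\rangle+|1\rangle|y\rangle)\,|f(s)\rangle|0^w\rangle\Bigr\|\le\delta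 . \] -/

import Mathlib

/-- Bit strings indexed by `κ`; they label the computational basis of a register of qubits `κ`. -/
abbrev Bits (κ : Type) : Type := κ → Bool

/-- State vectors of a register of qubits `κ`, with the Euclidean norm and inner product. -/
abbrev QState (κ : Type) [Fintype κ] [DecidableEq κ] : Type := EuclideanSpace ℂ (Bits κ)

/-- Unitary matrices on a register of qubits `κ`. -/
abbrev QUnitary (κ : Type) [Fintype κ] [DecidableEq κ] : Type := Matrix.unitaryGroup (Bits κ) ℂ

/-- `U` prepares `x`: it sends the all-zero basis state to `x`. -/
def Prepares {n : ℕ} (U : QUnitary (Fin n)) (x : QState (Fin n)) : Prop :=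
  ∀ a : Bits (Fin n), U.1 a (fun _ => false) = x a

/-- The matrix of `controlled-U`: the control is the qubit `none`, and `U` is applied to the
qubits `some i` when the control is 1. -/
def controlled {n : ℕ} (U : QUnitary (Fin n)) :
    Matrix (Bits (Option (Fin n))) (Bits (Option (Fin n))) ℂ :=
  fun z a =>
    if z none = a none then
      (if z none then U.1 (fun i => z (some i)) (fun i => a (some i))
        else if (fun i => z (some i)) = (fun i => a (some i)) then 1 else 0)
    else 0

/-- The matrix of the reversible evaluation
`|p⟩|q⟩|v⟩ ↦ |p⟩|q⟩|v ⊕ f (re p + i * im q)⟩`, where the bit strings `p` and `q` are read as the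
entries of two tables of real numbers. -/
def evaluation {k l b : ℕ} (f : ℂ → Bits (Fin b)) (re : Bits (Fin k) → ℝ) (im : Bits (Fin l) → ℝ) :
    Matrix (Bits (Fin k ⊕ (Fin l ⊕ Fin b))) (Bits (Fin k ⊕ (Fin l ⊕ Fin b))) ℂ :=
  fun z a =>
    if (∀ i, z (Sum.inl i) = a (Sum.inl i)) ∧ (∀ i, z (Sum.inr (Sum.inl i)) = a (Sum.inr (Sum.inl i))) ∧
        (∀ j, z (Sum.inr (Sum.inr j)) = xor (a (Sum.inr (Sum.inr j)))
          (f (⟨re (fun i => a (Sum.inl i)), im (fun i => a (Sum.inr (Sum.inl i)))⟩ : ℂ) j))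
    then 1 else 0

/-- Apply the matrix `A` to the qubits selected by `e` and the identity to all the others.
Here `Function.extend e a z` is `z` with the bits at the selected positions replaced by `a`. -/
noncomputable def applyOn {ι κ : Type} [Fintype ι] [DecidableEq ι] [Fintype κ] [DecidableEq κ]
    (e : κ ↪ ι) (A : Matrix (Bits κ) (Bits κ) ℂ) (ψ : QState ι) : QState ι :=
  WithLp.toLp 2 fun z => ∑ a : Bits κ, A (fun j => z (e j)) a * ψ (Function.extend e a z)

/-- One step of a quantum algorithm on qubits `ι` that has access to two preparation procedures for
`n`-qubit states and to a function with `b`-bit values. The steps do not mention these objects: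
they are only used as black boxes, see `Gate.run`.
* `elementary`: an arbitrary unitary on at most three qubits;
* `prepare`: a preparation procedure (the first one or the second one) or its inverse, controlled
  by one qubit;
* `evaluate`: reversible evaluation of the function at a number that is read off from two tables. -/
inductive Gate (ι : Type) (n b : ℕ) : Type
  | elementary (k : ℕ) (hk : k ≤ 3) (e : Fin k ↪ ι) (u : QUnitary (Fin k)) : Gate ι n b
  | prepare (second inverse : Bool) (e : Option (Fin n) ↪ ι) : Gate ι n b
  | evaluate (k l : ℕ) (re : Bits (Fin k) → ℝ) (im : Bits (Fin l) → ℝ)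
      (e : (Fin k ⊕ (Fin l ⊕ Fin b)) ↪ ι) : Gate ι n b

/-- The action of one step, when the preparation procedures are `U` and `V` and the function
is `f`. -/
noncomputable def Gate.run {ι : Type} [Fintype ι] [DecidableEq ι] {n b : ℕ}
    (U V : QUnitary (Fin n)) (f : ℂ → Bits (Fin b)) : Gate ι n b → QState ι → QState ι
  | .elementary _ _ e u => applyOn e u.1
  | .prepare second inverse e =>
      let W := if second then V else U
      applyOn e (controlled (if inverse then W⁻¹ else W))
  | .evaluate _ _ re im e => applyOn e (evaluation f re im)

/-- The time of one step, when a preparation takes time `T`: elementary gates take one unit, an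
evaluation takes the total length of the tables that are read plus one unit. -/
def Gate.time {ι : Type} {n b : ℕ} (T : ℕ) : Gate ι n b → ℕ
  | .elementary _ _ _ _ => 1
  | .prepare _ _ _ => T
  | .evaluate k l _ _ _ => 2 ^ k + 2 ^ l + 1

/-- A circuit is a list of steps, the head of the list being the first step. -/
abbrev Circuit (ι : Type) (n b : ℕ) : Type := List (Gate ι n b)

/-- The action of a circuit. -/
noncomputable def Circuit.run {ι : Type} [Fintype ι] [DecidableEq ι] {n b : ℕ}
    (U V : QUnitary (Fin n)) (f : ℂ → Bits (Fin b)) (c : Circuit ι n b) (ψ : QState ι) : QState ι :=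
  c.foldl (fun φ g => g.run U V f φ) ψ

/-- The running time of a circuit, when a preparation takes time `T`. -/
def Circuit.time {ι : Type} {n b : ℕ} (T : ℕ) (c : Circuit ι n b) : ℕ :=
  (c.map (Gate.time T)).sum

/-- The qubits of the algorithm: one control qubit, `n` data qubits, `b` output qubits,
`w` work qubits. -/
abbrev Wire (n b w : ℕ) : Type := Unit ⊕ (Fin n ⊕ (Fin b ⊕ Fin w))

/-- The state `(|0⟩|x⟩ + |1⟩|y⟩)/√2 ⊗ |v⟩ ⊗ |0…0⟩` of the control and data qubits, the output
qubits, and the work qubits. -/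
noncomputable def pairState {n b : ℕ} (w : ℕ) (x y : QState (Fin n)) (v : Bits (Fin b)) :
    QState (Wire n b w) :=
  WithLp.toLp 2 fun z =>
    if (∀ j, z (Sum.inr (Sum.inr (Sum.inl j))) = v j) ∧
        (∀ j, z (Sum.inr (Sum.inr (Sum.inr j))) = false) then
      ((1 / √2 : ℝ) : ℂ) *
        (if z (Sum.inl ()) then y (fun i => z (Sum.inr (Sum.inl i)))
          else x (fun i => z (Sum.inr (Sum.inl i))))
    else 0

/-! Let ψ = (|0⟩x + |1⟩y)/√2 (`pairVector`), and let S be the involution `twist`, which flips the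
control qubit with phases λ and λ⁻¹. Then ⟨ψ|Sψ⟩ = Re(λ⟨x|y⟩), so the number to be found is an
overlap that Grover-type rotations encode in a phase. On the span of ψ and Sψ, the product (1 -
2|ψ⟩⟨ψ|)S has characteristic polynomial μ² - 2dμ + 1 with d = -Re(λ⟨x|y⟩). Its eigenvalues are
therefore μ and its conjugate, of modulus 1 and real part d, and ψ is a sum of two eigenvectors
(`exists_groverMap_eigenvectors`). The choices λ = -1 and λ = i turn d into the real and the
imaginary part of ⟨x|y⟩. The reflection at ψ costs one preparation of ψ, one inverse preparation and
a sign flip at |0…0⟩.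

Phase estimation with k qubits uses about 2^k such products. The outcome z gives the estimate
cos(2πz/2^k) of d, and it does not matter which of the two conjugate eigenvalues is seen, because
they share their real part. The outcomes that miss d by at least η carry weight O(1/(η 2^k))
(`sum_far_estimator_le`). With η proportional to ε, a constant weight δ² costs 2^k = O(1/ε).

A good estimate is not yet a single number: different outcomes near d would give different values of
f and leave the output entangled with the work qubits. The estimates are therefore rounded to a grid
of width ε/2 shifted by r/R of that width, before f is evaluated. For each coordinate at most one
shift r has a grid point so close to the true value that good estimates can round differently
(`unstableShifts_subsingleton`). For all but two of the R shifts, every good outcome thus yields the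
same f(s). Undoing the estimations then restores the work qubits up to the small weight of bad
outcomes (`norm_innerProductCircuit_sub_le`). Taking R ≥ 2/δ makes the two exceptions a fraction at
most δ. -/

open Function

/-! ### Replacing bits at selected positions -/

section Extend

variable {ι κ μ α : Type}

lemma extend_restrict (e : κ ↪ ι) (z : ι → α) : extend e (fun j => z (e j)) z = z := by
  classical
  funext i
  by_cases h : ∃ j, e j = i
  · obtain ⟨j, rfl⟩ := h
    exact e.injective.extend_apply _ _ _
  · exact extend_apply' _ _ _ h

lemma extend_extend (e : κ ↪ ι) (a a' : κ → α) (z : ι → α) :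
    extend e a (extend e a' z) = extend e a z := by
  funext i
  by_cases h : ∃ j, e j = i
  · obtain ⟨j, rfl⟩ := h
    simp [e.injective.extend_apply]
  · simp [extend_apply' _ _ _ h]

lemma extend_trans (e : μ ↪ κ) (g : κ ↪ ι) (a : μ → α) (a' : κ → α) (z : ι → α) :
    extend (e.trans g) a (extend g a' z) = extend g (extend e a a') z := by
  funext i
  by_cases h : ∃ j, g j = i
  · obtain ⟨j, rfl⟩ := h
    rw [g.injective.extend_apply]
    by_cases h' : ∃ l, e l = j
    · obtain ⟨l, rfl⟩ := h'
      rw [e.injective.extend_apply]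
      exact (e.trans g).injective.extend_apply a _ l
    · rw [extend_apply' _ _ _ h', extend_apply', g.injective.extend_apply]
      rintro ⟨l, hl⟩
      exact h' ⟨l, g.injective hl⟩
  · rw [extend_apply' _ _ _ h, extend_apply', extend_apply' _ _ _ h]
    rintro ⟨l, hl⟩
    exact h ⟨e l, hl⟩

lemma extend_eq_of (e : κ ↪ ι) (a : κ → α) (z z' : ι → α) (h : ∀ j, z' (e j) = a j)
    (h' : ∀ i, (∀ j, e j ≠ i) → z' i = z i) : extend e a z = z' := by
  funext i
  by_cases hi : ∃ j, e j = i
  · obtain ⟨j, rfl⟩ := hi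
    rw [e.injective.extend_apply, h]
  · rw [extend_apply' _ _ _ hi, h' i (by simpa using hi)]

end Extend

/-! ### Matrices acting on part of a register -/

section ApplyOn

variable {ι κ μ : Type} [Fintype ι] [DecidableEq ι] [Fintype κ] [DecidableEq κ]
  [Fintype μ] [DecidableEq μ]

lemma applyOn_apply (e : κ ↪ ι) (A : Matrix (Bits κ) (Bits κ) ℂ) (ψ : QState ι) (z : Bits ι) :
    applyOn e A ψ z = ∑ a : Bits κ, A (fun j => z (e j)) a * ψ (extend e a z) := rfl

lemma applyOn_one (e : κ ↪ ι) (ψ : QState ι) : applyOn e 1 ψ = ψ := by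
  ext z
  simp [applyOn_apply, Matrix.one_apply, extend_restrict]

lemma applyOn_applyOn (e : κ ↪ ι) (A B : Matrix (Bits κ) (Bits κ) ℂ) (ψ : QState ι) :
    applyOn e A (applyOn e B ψ) = applyOn e (A * B) ψ := by
  ext z
  simp only [applyOn_apply, e.injective.extend_apply, extend_extend, Matrix.mul_apply,
    Finset.mul_sum, Finset.sum_mul]
  rw [Finset.sum_comm]
  simp only [mul_assoc]

lemma applyOn_add (e : κ ↪ ι) (A : Matrix (Bits κ) (Bits κ) ℂ) (ψ φ : QState ι) :
    applyOn e A (ψ + φ) = applyOn e A ψ + applyOn e A φ := by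
  ext z
  simp [applyOn_apply, mul_add, Finset.sum_add_distrib]

lemma applyOn_smul (e : κ ↪ ι) (A : Matrix (Bits κ) (Bits κ) ℂ) (c : ℂ) (ψ : QState ι) :
    applyOn e A (c • ψ) = c • applyOn e A ψ := by
  ext z
  simp [applyOn_apply, Finset.mul_sum, mul_left_comm]

/-- Exchange the bits at the positions selected by `e` with a separate string of bits. -/
noncomputable def exchange (e : κ ↪ ι) : (Bits ι × Bits κ) ≃ (Bits ι × Bits κ) where
  toFun u := (extend e u.2 u.1, fun j => u.1 (e j))
  invFun u := (extend e u.2 u.1, fun j => u.1 (e j))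
  left_inv u := by simp [extend_extend, extend_restrict, e.injective.extend_apply]
  right_inv u := by simp [extend_extend, extend_restrict, e.injective.extend_apply]

/-- Both sides are double sums over a basis state and a replacement string. The involution
`exchange` swaps the replaced bits with that string, which interchanges the roles of the two states
and of the row and column of `A`. -/
lemma inner_applyOn (e : κ ↪ ι) (A : Matrix (Bits κ) (Bits κ) ℂ) (ψ φ : QState ι) :
    inner ℂ (applyOn e A ψ) φ = inner ℂ ψ (applyOn e A.conjTranspose φ) := by
  simp only [PiLp.inner_apply, applyOn_apply, RCLike.inner_apply, map_sum, map_mul,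
    Finset.mul_sum, Finset.sum_mul, Matrix.conjTranspose_apply]
  rw [← Fintype.sum_prod_type', ← Fintype.sum_prod_type']
  refine Fintype.sum_equiv (exchange e) _ _ fun u => ?_
  simp only [exchange, Equiv.coe_fn_mk, e.injective.extend_apply, extend_extend, extend_restrict,
    RCLike.star_def]
  ring

lemma norm_applyOn (e : κ ↪ ι) (A : QUnitary κ) (ψ : QState ι) :
    ‖applyOn e A.1 ψ‖ = ‖ψ‖ := by
  have h : inner ℂ (applyOn e A.1 ψ) (applyOn e A.1 ψ) = inner ℂ ψ ψ := by
    rw [inner_applyOn, applyOn_applyOn]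
    have : A.1.conjTranspose * A.1 = 1 := Matrix.mem_unitaryGroup_iff'.1 A.2
    rw [this, applyOn_one]
  rw [inner_self_eq_norm_sq_to_K, inner_self_eq_norm_sq_to_K] at h
  have h' : ‖applyOn e A.1 ψ‖ ^ 2 = ‖ψ‖ ^ 2 := by exact_mod_cast h
  exact (pow_left_inj₀ (norm_nonneg _) (norm_nonneg _) two_ne_zero).1 h'

/-- The state of the qubits selected by `g` when the others are in the basis state `z`. -/
noncomputable def slice (g : κ ↪ ι) (z : Bits ι) (ψ : QState ι) : QState κ :=
  WithLp.toLp 2 fun a => ψ (extend g a z)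

lemma slice_apply (g : κ ↪ ι) (z : Bits ι) (ψ : QState ι) (a : Bits κ) :
    slice g z ψ a = ψ (extend g a z) := rfl

/-- An operation inside a subregister acts separately for each basis state of the remaining qubits.
This is what reduces a relabelled circuit to the original one. -/
lemma slice_applyOn_trans (e : μ ↪ κ) (g : κ ↪ ι) (A : Matrix (Bits μ) (Bits μ) ℂ)
    (z : Bits ι) (ψ : QState ι) :
    slice g z (applyOn (e.trans g) A ψ) = applyOn e A (slice g z ψ) := by
  ext a
  simp only [slice_apply, applyOn_apply, extend_trans]
  simp [Embedding.trans_apply, g.injective.extend_apply]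

end ApplyOn

/-! ### Permutations with phases, and the reversible evaluation -/

section Monomial

variable {κ : Type} [Fintype κ] [DecidableEq κ]

/-- The unitary `ψ ↦ (z ↦ s z * ψ (σ z))`. -/
noncomputable def monomialUnitary (σ : Equiv.Perm (Bits κ)) (s : Bits κ → Circle) : QUnitary κ :=
  ⟨Matrix.of fun z a => if a = σ z then (s z : ℂ) else 0, by
    rw [Matrix.mem_unitaryGroup_iff]
    ext z a
    by_cases h : z = a
    · subst h
      simp [Matrix.mul_apply, Matrix.star_apply, apply_ite, Complex.mul_conj]
    · simp [Matrix.mul_apply, Matrix.star_apply, apply_ite, h, Ne.symm h]⟩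

lemma applyOn_monomialUnitary {ι : Type} [Fintype ι] [DecidableEq ι] (e : κ ↪ ι)
    (σ : Equiv.Perm (Bits κ)) (s : Bits κ → Circle) (ψ : QState ι) (z : Bits ι) :
    applyOn e (monomialUnitary σ s).1 ψ z =
      s (fun j => z (e j)) * ψ (extend e (σ fun j => z (e j)) z) := by
  simp [applyOn_apply, monomialUnitary]

end Monomial

section Evaluation

variable {k l b : ℕ}

/-- The permutation of the basis states behind `evaluation`. -/
def evaluationPerm (f : ℂ → Bits (Fin b)) (re : Bits (Fin k) → ℝ) (im : Bits (Fin l) → ℝ) :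
    Equiv.Perm (Bits (Fin k ⊕ (Fin l ⊕ Fin b))) :=
  Involutive.toPerm (fun a => Sum.elim (fun i => a (Sum.inl i))
    (Sum.elim (fun i => a (Sum.inr (Sum.inl i))) fun j => xor (a (Sum.inr (Sum.inr j)))
      (f (⟨re (fun i => a (Sum.inl i)), im (fun i => a (Sum.inr (Sum.inl i)))⟩ : ℂ) j)))
    (by
      intro a
      funext i
      rcases i with i | i | i <;> simp)

/-- `evaluation` determines the row from the column, `monomialUnitary` the column from the row. The
two agree because adding the value of `f` twice modulo 2 cancels, so the permutation is its own
inverse. -/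
lemma evaluation_eq (f : ℂ → Bits (Fin b)) (re : Bits (Fin k) → ℝ) (im : Bits (Fin l) → ℝ) :
    evaluation f re im = (monomialUnitary (evaluationPerm f re im) 1).1 := by
  ext z a
  have key : ((∀ i, z (Sum.inl i) = a (Sum.inl i)) ∧
      (∀ i, z (Sum.inr (Sum.inl i)) = a (Sum.inr (Sum.inl i))) ∧
        (∀ j, z (Sum.inr (Sum.inr j)) = xor (a (Sum.inr (Sum.inr j)))
          (f (⟨re (fun i => a (Sum.inl i)), im (fun i => a (Sum.inr (Sum.inl i)))⟩ : ℂ) j))) ↔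
      a = evaluationPerm f re im z := by
    rw [← Equiv.symm_apply_eq, eq_comm]
    constructor
    · rintro ⟨h1, h2, h3⟩
      funext i
      rcases i with i | i | i
      · exact h1 i
      · exact h2 i
      · exact h3 i
    · intro h
      refine ⟨fun i => ?_, fun i => ?_, fun i => ?_⟩ <;> rw [h] <;> rfl
  simp only [evaluation, monomialUnitary, key]
  simp

end Evaluation

/-! ### Controlled unitaries -/

section Controlled

variable {n : ℕ}

/-- The equivalence that splits off the control bit. -/
def bitsOptionEquiv : Bits (Option (Fin n)) ≃ Bool × Bits (Fin n) where
  toFun z := (z none, fun i => z (some i))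
  invFun u := fun i => i.elim u.1 u.2
  left_inv z := by funext i; cases i <;> rfl
  right_inv u := rfl

lemma controlled_mul (A B : QUnitary (Fin n)) :
    controlled A * controlled B = controlled (A * B) := by
  ext z a
  rw [Matrix.mul_apply, ← bitsOptionEquiv.symm.sum_comp]
  rw [Fintype.sum_prod_type]
  have h : ∀ (c : Bool) (u : Bits (Fin n)), (bitsOptionEquiv.symm (c, u)) none = c := fun _ _ => rfl
  have h' : ∀ (c : Bool) (u : Bits (Fin n)) (i : Fin n),
    (bitsOptionEquiv.symm (c, u)) (some i) = u i := fun _ _ _ => rfl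
  simp only [controlled, h, h', Fintype.sum_bool]
  cases hz : z none <;> cases ha : a none <;> simp [Matrix.mul_apply]

lemma controlled_one : controlled (1 : QUnitary (Fin n)) = 1 := by
  ext z a
  have : z = a ↔ z none = a none ∧ (fun i => z (some i)) = (fun i => a (some i)) := by
    rw [← bitsOptionEquiv.injective.eq_iff]
    exact Prod.mk_inj
  simp only [controlled, Matrix.one_apply, this, OneMemClass.coe_one]
  by_cases h : z none = a none <;> simp [h]

lemma controlled_conjTranspose (A : QUnitary (Fin n)) :
    (controlled A).conjTranspose = controlled A⁻¹ := by
  ext z a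
  have hA : ∀ u v, (A⁻¹ : QUnitary (Fin n)).1 u v = star (A.1 v u) := fun u v => rfl
  simp only [controlled, Matrix.conjTranspose_apply, hA]
  by_cases h : a none = z none
  · rw [if_pos h, if_pos h.symm]
    cases hz : z none
    · simp [h, hz, apply_ite star, eq_comm]
    · simp [h, hz]
  · rw [if_neg h, if_neg (Ne.symm h), star_zero]

/-- `controlled U` as an element of the unitary group. -/
noncomputable def controlledUnitary (A : QUnitary (Fin n)) : QUnitary (Option (Fin n)) :=
  ⟨controlled A, by
    rw [Matrix.mem_unitaryGroup_iff, Matrix.star_eq_conjTranspose, controlled_conjTranspose,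
      controlled_mul, mul_inv_cancel, controlled_one]⟩

end Controlled

/-! ### Circuits: inverse, relabelling, linearity, unitarity -/

section Circuits

variable {ι κ : Type} {n b : ℕ}

/-- The inverse of a step. -/
noncomputable def Gate.inv : Gate ι n b → Gate ι n b
  | .elementary k hk e u => .elementary k hk e u⁻¹
  | .prepare second inverse e => .prepare second (!inverse) e
  | .evaluate k l re im e => .evaluate k l re im e

/-- Move a step to other qubits. -/
def Gate.relabel (g : κ ↪ ι) : Gate κ n b → Gate ι n b
  | .elementary k hk e u => .elementary k hk (e.trans g) u
  | .prepare second inverse e => .prepare second inverse (e.trans g)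
  | .evaluate k l re im e => .evaluate k l re im (e.trans g)

/-- The inverse of a circuit. -/
noncomputable def Circuit.inv (c : Circuit ι n b) : Circuit ι n b := (c.map Gate.inv).reverse

/-- Move a circuit to other qubits. -/
def Circuit.relabel (g : κ ↪ ι) (c : Circuit κ n b) : Circuit ι n b := List.map (Gate.relabel g) c

lemma Circuit.time_append (T : ℕ) (c d : Circuit ι n b) :
    Circuit.time T (c ++ d) = c.time T + d.time T := by
  simp [Circuit.time]

lemma Circuit.time_nil (T : ℕ) : Circuit.time T ([] : Circuit ι n b) = 0 := rfl

lemma Circuit.time_cons (T : ℕ) (g : Gate ι n b) (c : Circuit ι n b) :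
    Circuit.time T (g :: c) = g.time T + Circuit.time T c := by
  simp [Circuit.time]

lemma Circuit.time_inv (T : ℕ) (c : Circuit ι n b) : c.inv.time T = c.time T := by
  have : Gate.time T ∘ Gate.inv = (Gate.time T : Gate ι n b → ℕ) := by
    funext g
    cases g <;> rfl
  simp [Circuit.time, Circuit.inv, List.sum_reverse, this]

lemma Circuit.time_relabel (T : ℕ) (g : κ ↪ ι) (c : Circuit κ n b) :
    (c.relabel g).time T = c.time T := by
  have : Gate.time T ∘ Gate.relabel g = (Gate.time T : Gate κ n b → ℕ) := by
    funext g
    cases g <;> rfl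
  simp [Circuit.time, Circuit.relabel, this]

lemma Circuit.inv_cons (g : Gate ι n b) (c : Circuit ι n b) :
    Circuit.inv (g :: c) = c.inv ++ [g.inv] := by
  simp [Circuit.inv]

open Classical in
/-- An elementary step on the qubits listed by `v`, which have to be distinct. -/
noncomputable def localGate {k : ℕ} (v : Fin k → ι) (u : QUnitary (Fin k)) : Gate ι n b :=
  if h : k ≤ 3 ∧ Injective v then .elementary k h.1 ⟨v, h.2⟩ u
  else .elementary 0 (by norm_num) ⟨Fin.elim0, fun i => i.elim0⟩ 1

lemma localGate_time {k : ℕ} (v : Fin k → ι) (u : QUnitary (Fin k)) (T : ℕ) :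
    (localGate v u : Gate ι n b).time T = 1 := by
  rw [localGate]
  split_ifs <;> rfl

variable [Fintype ι] [DecidableEq ι] [Fintype κ] [DecidableEq κ]
variable (U V : QUnitary (Fin n)) (f : ℂ → Bits (Fin b))

/-- A uniform description of all three kinds of steps, from which linearity, norm preservation and
the adjoint follow without further case distinctions. -/
lemma Gate.run_eq_applyOn (g : Gate ι n b) :
    ∃ (m : Type) (_ : Fintype m) (_ : DecidableEq m) (e : m ↪ ι) (A : QUnitary m),
      (∀ ψ, g.run U V f ψ = applyOn e A.1 ψ) ∧ ∀ ψ, g.inv.run U V f ψ = applyOn e (A⁻¹).1 ψ := by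
  cases g with
  | elementary k hk e u => exact ⟨_, _, _, e, u, fun _ => rfl, fun _ => rfl⟩
  | prepare s i e =>
    refine ⟨_, inferInstance, inferInstance, e,
      controlledUnitary (if i then (if s then V else U)⁻¹ else if s then V else U),
      fun _ => rfl, fun ψ => ?_⟩
    have : (controlledUnitary (if i then (if s then V else U)⁻¹ else if s then V else U))⁻¹.1
        = controlled (if i then (if s then V else U)⁻¹ else if s then V else U)⁻¹ :=
      controlled_conjTranspose _
    rw [this]
    cases i <;> simp [Gate.inv, Gate.run]
  | evaluate k l re im e =>
    refine ⟨_, inferInstance, inferInstance, e, monomialUnitary (evaluationPerm f re im) 1,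
      fun ψ => ?_, fun ψ => ?_⟩
    · rw [← evaluation_eq]; rfl
    · have h : monomialUnitary (evaluationPerm f re im) 1 *
          monomialUnitary (evaluationPerm f re im) 1 = 1 := by
        apply Subtype.ext
        ext z a
        have h2 : evaluationPerm f re im (evaluationPerm f re im z) = z :=
          (evaluationPerm f re im).left_inv z
        refine (Matrix.mul_apply ..).trans ?_
        rw [Finset.sum_eq_single (evaluationPerm f re im z)]
        · simp [monomialUnitary, Matrix.one_apply, h2, eq_comm]
        · intro j _ hj
          simp [monomialUnitary, hj]
        · simp
      rw [inv_eq_of_mul_eq_one_left h, ← evaluation_eq]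
      rfl

lemma Gate.run_add (g : Gate ι n b) (ψ φ : QState ι) :
    g.run U V f (ψ + φ) = g.run U V f ψ + g.run U V f φ := by
  obtain ⟨m, _, _, e, A, h, -⟩ := g.run_eq_applyOn U V f
  simp only [h, applyOn_add]

lemma Gate.run_smul (g : Gate ι n b) (c : ℂ) (ψ : QState ι) :
    g.run U V f (c • ψ) = c • g.run U V f ψ := by
  obtain ⟨m, _, _, e, A, h, -⟩ := g.run_eq_applyOn U V f
  simp only [h, applyOn_smul]

lemma Gate.norm_run (g : Gate ι n b) (ψ : QState ι) : ‖g.run U V f ψ‖ = ‖ψ‖ := by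
  obtain ⟨m, _, _, e, A, h, -⟩ := g.run_eq_applyOn U V f
  rw [h, norm_applyOn]

lemma Gate.run_inv_run (g : Gate ι n b) (ψ : QState ι) :
    g.inv.run U V f (g.run U V f ψ) = ψ := by
  obtain ⟨m, _, _, e, A, h, h'⟩ := g.run_eq_applyOn U V f
  rw [h, h', applyOn_applyOn]
  have : (A⁻¹).1 * A.1 = 1 := congrArg Subtype.val (inv_mul_cancel A)
  rw [this, applyOn_one]

lemma Gate.run_run_inv (g : Gate ι n b) (ψ : QState ι) :
    g.run U V f (g.inv.run U V f ψ) = ψ := by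
  obtain ⟨m, _, _, e, A, h, h'⟩ := g.run_eq_applyOn U V f
  rw [h, h', applyOn_applyOn]
  have : A.1 * (A⁻¹).1 = 1 := congrArg Subtype.val (mul_inv_cancel A)
  rw [this, applyOn_one]

lemma Gate.inner_run (g : Gate ι n b) (ψ φ : QState ι) :
    inner ℂ (g.run U V f ψ) φ = inner ℂ ψ (g.inv.run U V f φ) := by
  obtain ⟨m, _, _, e, A, h, h'⟩ := g.run_eq_applyOn U V f
  rw [h, h', inner_applyOn]
  rfl

lemma Gate.slice_run_relabel (g : κ ↪ ι) (G : Gate κ n b) (z : Bits ι) (ψ : QState ι) :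
    slice g z ((G.relabel g).run U V f ψ) = G.run U V f (slice g z ψ) := by
  cases G <;> exact slice_applyOn_trans _ _ _ _ _

lemma Circuit.run_nil (ψ : QState ι) : Circuit.run U V f [] ψ = ψ := rfl

lemma Circuit.run_cons (g : Gate ι n b) (c : Circuit ι n b) (ψ : QState ι) :
    Circuit.run U V f (g :: c) ψ = Circuit.run U V f c (g.run U V f ψ) := rfl

lemma Circuit.run_append (c d : Circuit ι n b) (ψ : QState ι) :
    Circuit.run U V f (c ++ d) ψ = d.run U V f (c.run U V f ψ) := by
  simp [Circuit.run]

lemma Circuit.run_add (c : Circuit ι n b) (ψ φ : QState ι) :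
    c.run U V f (ψ + φ) = c.run U V f ψ + c.run U V f φ := by
  induction c generalizing ψ φ with
  | nil => rfl
  | cons g c ih => simp only [Circuit.run_cons, Gate.run_add, ih]

lemma Circuit.run_smul (c : Circuit ι n b) (a : ℂ) (ψ : QState ι) :
    c.run U V f (a • ψ) = a • c.run U V f ψ := by
  induction c generalizing ψ with
  | nil => rfl
  | cons g c ih => simp only [Circuit.run_cons, Gate.run_smul, ih]

lemma Circuit.run_sub (c : Circuit ι n b) (ψ φ : QState ι) :
    c.run U V f (ψ - φ) = c.run U V f ψ - c.run U V f φ := by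
  rw [sub_eq_add_neg, ← neg_one_smul ℂ φ, Circuit.run_add, Circuit.run_smul, neg_one_smul,
    ← sub_eq_add_neg]

lemma Circuit.norm_run (c : Circuit ι n b) (ψ : QState ι) : ‖c.run U V f ψ‖ = ‖ψ‖ := by
  induction c generalizing ψ with
  | nil => rfl
  | cons g c ih => rw [Circuit.run_cons, ih, Gate.norm_run]

lemma Circuit.run_inv_run (c : Circuit ι n b) (ψ : QState ι) :
    c.inv.run U V f (c.run U V f ψ) = ψ := by
  induction c generalizing ψ with
  | nil => rfl
  | cons g c ih =>
    rw [Circuit.inv_cons, Circuit.run_append, Circuit.run_cons U V f g c, ih]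
    exact Gate.run_inv_run U V f g ψ

lemma Circuit.run_run_inv (c : Circuit ι n b) (ψ : QState ι) :
    c.run U V f (c.inv.run U V f ψ) = ψ := by
  induction c generalizing ψ with
  | nil => rfl
  | cons g c ih =>
    rw [Circuit.inv_cons, Circuit.run_append, Circuit.run_cons, Circuit.run_cons, Circuit.run_nil,
      Gate.run_run_inv, ih]

lemma Circuit.inner_run (c : Circuit ι n b) (ψ φ : QState ι) :
    inner ℂ (c.run U V f ψ) φ = inner ℂ ψ (c.inv.run U V f φ) := by
  induction c generalizing ψ φ with
  | nil => rfl
  | cons g c ih =>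
    rw [Circuit.inv_cons, Circuit.run_append, Circuit.run_cons, Circuit.run_cons, Circuit.run_nil,
      ih, Gate.inner_run]

lemma Circuit.slice_run_relabel (g : κ ↪ ι) (c : Circuit κ n b) (z : Bits ι) (ψ : QState ι) :
    slice g z ((c.relabel g).run U V f ψ) = c.run U V f (slice g z ψ) := by
  induction c generalizing ψ with
  | nil => rfl
  | cons G c ih =>
    have : Circuit.relabel g (G :: c) = G.relabel g :: Circuit.relabel g c := rfl
    rw [this, Circuit.run_cons, Circuit.run_cons, ih, Gate.slice_run_relabel]

lemma Circuit.run_relabel_apply (g : κ ↪ ι) (c : Circuit κ n b) (z : Bits ι) (ψ : QState ι) :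
    (c.relabel g).run U V f ψ z = c.run U V f (slice g z ψ) (fun j => z (g j)) := by
  rw [← Circuit.slice_run_relabel, slice_apply, extend_restrict]

/-- The factor `χ` does not see the qubits of `g`, so it is a scalar on each slice and linearity
moves it out. This lets one estimator run while everything else is a spectator. -/
lemma Circuit.run_relabel_mul (g : κ ↪ ι) (c : Circuit κ n b) (φ : QState κ) (χ : Bits ι → ℂ)
    (hχ : ∀ a z, χ (extend g a z) = χ z) :
    (c.relabel g).run U V f (WithLp.toLp 2 fun z => φ (fun j => z (g j)) * χ z) =
      WithLp.toLp 2 fun z => c.run U V f φ (fun j => z (g j)) * χ z := by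
  ext z
  rw [Circuit.run_relabel_apply]
  have : slice g z (WithLp.toLp 2 fun z => φ (fun j => z (g j)) * χ z) = χ z • φ := by
    ext a
    simp [slice_apply, hχ, g.injective.extend_apply, mul_comm]
  rw [this, Circuit.run_smul]
  simp [mul_comm]

lemma localGate_run {k : ℕ} (v : Fin k → ι) (u : QUnitary (Fin k)) (hk : k ≤ 3) (hv : Injective v)
    (ψ : QState ι) :
    (localGate v u : Gate ι n b).run U V f ψ = applyOn ⟨v, hv⟩ u.1 ψ := by
  rw [localGate, dif_pos ⟨hk, hv⟩]
  rfl

/-- The Hadamard matrix. -/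
noncomputable def hadamardUnitary : QUnitary (Fin 1) :=
  ⟨Matrix.of fun z a => ((1 / √2 : ℝ) : ℂ) * (if z 0 && a 0 then -1 else 1), by
    have h2 : ((√2 : ℝ) : ℂ)⁻¹ * ((√2 : ℝ) : ℂ)⁻¹ = 1 / 2 := by
      rw [← mul_inv]
      norm_cast
      norm_num
    have key : ∀ x y : Bool, (∑ c : Bool, (((1 / √2 : ℝ) : ℂ) * (if x && c then -1 else 1)) *
        star (((1 / √2 : ℝ) : ℂ) * (if y && c then -1 else 1))) = if x = y then 1 else 0 := by
      intro x y
      cases x <;> cases y <;> simp [h2] <;> norm_num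
    rw [Matrix.mem_unitaryGroup_iff]
    ext z a
    rw [Matrix.mul_apply, ← (Equiv.funUnique (Fin 1) Bool).symm.sum_comp, Matrix.one_apply]
    refine (key (z 0) (a 0)).trans ?_
    have : z = a ↔ z 0 = a 0 := by
      rw [← (Equiv.funUnique (Fin 1) Bool).injective.eq_iff]; rfl
    simp only [this]⟩

/-- The Hadamard step on one qubit. -/
noncomputable def hadamard (i : ι) : Gate ι n b := localGate (fun _ => i) hadamardUnitary

lemma hadamard_run (i : ι) (ψ : QState ι) (z : Bits ι) :
    (hadamard i : Gate ι n b).run U V f ψ z = ((1 / √2 : ℝ) : ℂ) *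
      (ψ (update z i false) + (if z i then -1 else 1) * ψ (update z i true)) := by
  have hv : Injective (fun _ : Fin 1 => i) := fun _ _ _ => Subsingleton.elim _ _
  rw [hadamard, localGate_run U V f _ _ (by norm_num) hv, applyOn_apply,
    ← (Equiv.funUnique (Fin 1) Bool).symm.sum_comp, Fintype.sum_bool]
  have h : ∀ c : Bool, extend (⟨fun _ : Fin 1 => i, hv⟩ : Fin 1 ↪ ι)
      ((Equiv.funUnique (Fin 1) Bool).symm c) z = update z i c := by
    intro c
    refine extend_eq_of _ _ _ _ (fun j => by simp) fun i' hi' => ?_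
    rw [update_of_ne]
    exact fun h => hi' 0 h.symm
  rw [h, h]
  simp only [hadamardUnitary, Embedding.coeFn_mk]
  simp
  cases z i <;> simp <;> ring

/-- The step `ψ ↦ (z ↦ s z * ψ (σ z))` on the qubits listed by `v`. -/
noncomputable def monomialGate {k : ℕ} (v : Fin k → ι) (σ : Equiv.Perm (Bits (Fin k)))
    (s : Bits (Fin k) → Circle) : Gate ι n b := localGate v (monomialUnitary σ s)

lemma monomialGate_run {k : ℕ} (v : Fin k → ι) (σ : Equiv.Perm (Bits (Fin k)))
    (s : Bits (Fin k) → Circle) (hk : k ≤ 3) (hv : Injective v) (ψ : QState ι) (z z' : Bits ι)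
    (h : ∀ j, z' (v j) = σ (fun j => z (v j)) j) (h' : ∀ i, (∀ j, v j ≠ i) → z' i = z i) :
    (monomialGate v σ s : Gate ι n b).run U V f ψ z = s (fun j => z (v j)) * ψ z' := by
  rw [monomialGate, localGate_run U V f v _ hk hv, applyOn_monomialUnitary]
  exact congrArg (fun y => (s (fun j => z (v j)) : ℂ) * ψ y)
    (extend_eq_of (⟨v, hv⟩ : Fin k ↪ ι) _ z z' h h')

end Circuits

/-! ### Preparation of the pair state -/

section PairPreparation

variable {n b : ℕ} (U V : QUnitary (Fin n)) (f : ℂ → Bits (Fin b))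

/-- The basis state `|0…0⟩`. -/
noncomputable def zeroState (κ : Type) [Fintype κ] [DecidableEq κ] : QState κ :=
  WithLp.toLp 2 fun z => if ∀ i, z i = false then 1 else 0

/-- The state `(|0⟩|x⟩ + |1⟩|y⟩)/√2`. -/
noncomputable def pairVector (x y : QState (Fin n)) : QState (Option (Fin n)) :=
  WithLp.toLp 2 fun z => ((1 / √2 : ℝ) : ℂ) *
    (if z none then y (fun i => z (some i)) else x (fun i => z (some i)))

/-- The NOT step on one qubit. -/
noncomputable def notGate {ι : Type} (i : ι) : Gate ι n b :=
  monomialGate (fun _ : Fin 1 => i) (Involutive.toPerm (fun w j => !w j) fun w => by simp) 1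

lemma notGate_run {ι : Type} [Fintype ι] [DecidableEq ι] (i : ι) (ψ : QState ι) (z : Bits ι) :
    (notGate i : Gate ι n b).run U V f ψ z = ψ (update z i (!z i)) := by
  rw [notGate, monomialGate_run U V f _ _ _ (by norm_num) (fun _ _ _ => Subsingleton.elim _ _) ψ z
    (update z i (!z i))]
  · simp
  · intro j
    change update z i (!z i) i = !z i
    simp
  · intro i' hi'
    exact update_of_ne (hi' 0).symm _ _

/-- A circuit that maps `|0…0⟩` to the pair of the two prepared states. -/
noncomputable def preparePair : Circuit (Option (Fin n)) n b :=
  [hadamard none, .prepare false false (Embedding.refl _), notGate none,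
    .prepare true false (Embedding.refl _)]

lemma applyOn_controlled (A : QUnitary (Fin n)) (ψ : QState (Option (Fin n)))
    (z : Bits (Option (Fin n))) :
    applyOn (Embedding.refl _) (controlled A) ψ z =
      if z none then ∑ a, A.1 (fun i => z (some i)) a * ψ (bitsOptionEquiv.symm (true, a))
      else ψ z := by
  have hext : ∀ a : Bits (Option (Fin n)), extend (Embedding.refl (Option (Fin n))) a z = a :=
    fun a => funext fun i => (Embedding.refl _).injective.extend_apply a z i
  simp only [applyOn_apply, hext, Embedding.refl_apply]
  rw [← bitsOptionEquiv.symm.sum_comp, Fintype.sum_prod_type, Fintype.sum_bool]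
  have h : ∀ (c : Bool) (u : Bits (Fin n)), (bitsOptionEquiv.symm (c, u)) none = c := fun _ _ => rfl
  have h' : ∀ (c : Bool) (u : Bits (Fin n)) (i : Fin n),
    (bitsOptionEquiv.symm (c, u)) (some i) = u i := fun _ _ _ => rfl
  simp only [controlled, h, h']
  cases hz : z none
  · have : bitsOptionEquiv.symm (false, fun i => z (some i)) = z := by
      rw [← hz]
      exact bitsOptionEquiv.symm_apply_apply z
    simp [this]
  · simp

/-- After the Hadamard step, controlled `U` writes `x` in the branch with control 1. The NOT turns
this into the branch with control 0, and controlled `V` then writes `y` in the other branch, whose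
data are still zero. -/
lemma preparePair_run {x y : QState (Fin n)} (hx : Prepares U x) (hy : Prepares V y) :
    (preparePair : Circuit _ n b).run U V f (zeroState _) = pairVector x y := by
  have hU : ∀ a : Bits (Fin n), (∑ u, U.1 a u * if ∀ i, u i = false then (1 : ℂ) else 0) = x a := by
    intro a
    rw [← hx a, Finset.sum_eq_single fun _ => false]
    · simp
    · intro u _ hu
      rw [if_neg, mul_zero]
      exact fun h => hu (funext h)
    · simp
  have hV : ∀ a : Bits (Fin n), (∑ u, V.1 a u * if ∀ i, u i = false then (1 : ℂ) else 0) = y a := by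
    intro a
    rw [← hy a, Finset.sum_eq_single fun _ => false]
    · simp
    · intro u _ hu
      rw [if_neg, mul_zero]
      exact fun h => hu (funext h)
    · simp
  set s : ℂ := ((1 / √2 : ℝ) : ℂ) with hs
  have h1 : ∀ z : Bits (Option (Fin n)), (hadamard none : Gate _ n b).run U V f (zeroState _) z =
      s * if ∀ i, z (some i) = false then 1 else 0 := by
    intro z
    rw [hadamard_run]
    simp [zeroState, Option.forall, hs]
  have h2 : ∀ z : Bits (Option (Fin n)),
      (Gate.prepare false false (Embedding.refl _) : Gate _ n b).run U V f
        ((hadamard none : Gate _ n b).run U V f (zeroState _)) z =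
      if z none then s * x (fun i => z (some i)) else
        s * if ∀ i, z (some i) = false then 1 else 0 := by
    intro z
    refine (applyOn_controlled U _ z).trans ?_
    simp only [h1]
    rw [← hU, Finset.mul_sum]
    congr 1
    refine Finset.sum_congr rfl fun a _ => ?_
    exact mul_left_comm _ _ _
  ext z
  simp only [preparePair, Circuit.run_cons, Circuit.run_nil]
  refine (applyOn_controlled V _ z).trans ?_
  simp only [notGate_run, h2]
  cases hz : z none
  · simp [hz, pairVector, hs]
  · rw [if_pos rfl]
    simp only [pairVector, hz, if_true]
    rw [← hV, Finset.mul_sum]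
    refine Finset.sum_congr rfl fun a _ => ?_
    rw [← hs, mul_left_comm]
    congr 2

lemma preparePair_time (T : ℕ) : (preparePair : Circuit _ n b).time T = 2 * T + 2 := by
  simp only [preparePair, Circuit.time_cons, Circuit.time_nil, hadamard, notGate, monomialGate,
    localGate_time]
  simp only [Gate.time]
  ring

end PairPreparation

/-! ### Controlled sign flip at the zero state, from three-qubit steps -/

section SignFlip

variable {ι κ : Type} {n b : ℕ}

/-- The step `|a⟩|d⟩|t⟩ ↦ |a⟩|d⟩|t ⊕ (a ∧ ¬ d)⟩`. -/
noncomputable def andNotGate (a d t : ι) : Gate ι n b :=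
  monomialGate ![a, d, t] (Involutive.toPerm (fun w => update w 2 (xor (w 2) (w 0 && !w 1)))
    fun w => by
      funext i
      fin_cases i <;> simp [update]) 1

/-- The circuit that flips the sign if the bit at `a` is 1 and the bits at `data i`, for `i` in a
list, are all 0. The qubits `anc i` are ancillas. -/
noncomputable def signFlip (data anc : κ → ι) : ι → List κ → Circuit ι n b
  | a, [] => [monomialGate ![a] 1 fun w => if w 0 then Circle.exp Real.pi else 1]
  | a, i :: L => andNotGate a (data i) (anc i) ::
      (signFlip data anc (anc i) L ++ [andNotGate a (data i) (anc i)])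

/-- The phase that is applied by `signFlip`. -/
def signFlipPhase [DecidableEq ι] (data anc : κ → ι) : ι → List κ → Bits ι → ℂ
  | a, [], z => if z a then -1 else 1
  | a, i :: L, z => signFlipPhase data anc (anc i) L
      (update z (anc i) (xor (z (anc i)) (z a && !z (data i))))

lemma signFlip_time (data anc : κ → ι) (a : ι) (L : List κ) (T : ℕ) :
    (signFlip data anc a L : Circuit ι n b).time T = 2 * L.length + 1 := by
  induction L generalizing a with
  | nil => simp [signFlip, Circuit.time_cons, Circuit.time_nil, monomialGate, localGate_time]
  | cons i L ih =>
    simp only [signFlip, Circuit.time_cons, Circuit.time_append, Circuit.time_nil, ih, andNotGate,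
      monomialGate, localGate_time, List.length_cons]
    ring

/-- With clean ancillas, each one receives the conjunction of the preceding bit with the negated
data bit, so the last one holds the conjunction of the whole list. -/
lemma signFlipPhase_eq [DecidableEq ι] {data anc : κ → ι} (hanc : Injective anc) (hda : ∀ i j, data i ≠ anc j)
    (a : ι) (L : List κ) (hL : L.Nodup) (z : Bits ι) (hz : ∀ i ∈ L, z (anc i) = false) :
    signFlipPhase data anc a L z =
      if z a = true ∧ ∀ i ∈ L, z (data i) = false then -1 else 1 := by
  induction L generalizing a z with
  | nil => simp [signFlipPhase]
  | cons i L ih =>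
    rw [signFlipPhase, ih (anc i) (List.nodup_cons.1 hL).2]
    · simp [hda, hz i, and_assoc]
    · intro j hj
      rw [update_of_ne, hz j (by simp [hj])]
      exact fun h => (List.nodup_cons.1 hL).1 (hanc h ▸ hj)

variable [Fintype ι] [DecidableEq ι] (U V : QUnitary (Fin n)) (f : ℂ → Bits (Fin b))

lemma andNotGate_run (a d t : ι) (had : a ≠ d) (hat : a ≠ t) (hdt : d ≠ t) (ψ : QState ι)
    (z : Bits ι) :
    (andNotGate a d t : Gate ι n b).run U V f ψ z = ψ (update z t (xor (z t) (z a && !z d))) := by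
  have hv : Injective ![a, d, t] := by
    intro i j hij
    fin_cases i <;> fin_cases j <;> simp_all
  rw [andNotGate, monomialGate_run U V f _ _ _ le_rfl hv ψ z
    (update z t (xor (z t) (z a && !z d)))]
  · simp
  · intro j
    change _ = update (fun j => z (![a, d, t] j)) 2 (xor (z t) (z a && !z d)) j
    fin_cases j <;> simp [hat, hdt]
  · intro i hi
    exact update_of_ne (hi 2).symm _ _

/-- Each conjunction step is an involution and is applied again after a diagonal operation, so the
net effect is diagonal. This holds for arbitrary contents of the ancillas. -/
lemma signFlip_run {data anc : κ → ι} (hanc : Injective anc) (hda : ∀ i j, data i ≠ anc j) (a : ι)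
    (ha : ∀ i, a ≠ data i) (L : List κ) (hL : L.Nodup) (haL : ∀ i ∈ L, a ≠ anc i) (ψ : QState ι)
    (z : Bits ι) :
    (signFlip data anc a L : Circuit ι n b).run U V f ψ z = signFlipPhase data anc a L z * ψ z := by
  induction L generalizing a ψ z with
  | nil =>
    simp only [signFlip, Circuit.run_cons, Circuit.run_nil]
    rw [monomialGate_run U V f _ _ _ (by norm_num) (fun _ _ _ => Subsingleton.elim _ _) ψ z z
      (by simp) (by simp)]
    cases h : z a <;> simp [signFlipPhase, h]
  | cons i L ih =>
    have h1 : a ≠ anc i := haL i (by simp)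
    simp only [signFlip, Circuit.run_cons, Circuit.run_append, Circuit.run_nil]
    rw [andNotGate_run U V f _ _ _ (ha i) h1 (hda i i),
      ih (anc i) (fun j => (hda j i).symm) (List.nodup_cons.1 hL).2
        (fun j hj h => (List.nodup_cons.1 hL).1 (hanc h ▸ hj)),
      andNotGate_run U V f _ _ _ (ha i) h1 (hda i i), signFlipPhase]
    have hz : ∀ z' : Bits ι, z' = update z (anc i) (xor (z (anc i)) (z a && !z (data i))) →
        update z' (anc i) (xor (z' (anc i)) (z' a && !z' (data i))) = z := by
      rintro _ rfl
      simp [h1, hda i i]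
    rw [hz _ rfl]

end SignFlip

/-! ### The controlled product of two reflections -/

section Grover

variable {n b k : ℕ}

/-- The qubits of an estimator: the pair register, as many ancillas, and `k` phase qubits. -/
abbrev EstimatorWire (n k : ℕ) : Type := (Option (Fin n) ⊕ Option (Fin n)) ⊕ Fin k

/-- The position of the pair register in the estimator. -/
def pairEmbedding : Option (Fin n) ↪ EstimatorWire n k := Embedding.inl.trans Embedding.inl

/-- The state `∑ p, F p ⊗ |0…0⟩ ⊗ |p⟩` of the estimator. -/
noncomputable def bundle (F : Bits (Fin k) → QState (Option (Fin n))) :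
    QState (EstimatorWire n k) :=
  WithLp.toLp 2 fun z => if ∀ i, z (Sum.inl (Sum.inr i)) = false then
    F (fun j => z (Sum.inr j)) (fun i => z (Sum.inl (Sum.inl i))) else 0

/-- Change the sign of the amplitude of `|0…0⟩`. -/
noncomputable def flipZero {κ : Type} [Fintype κ] [DecidableEq κ] (φ : QState κ) : QState κ :=
  WithLp.toLp 2 fun a => if ∀ i, a i = false then -φ a else φ a

/-- Apply `!![0, lam; conj lam, 0]` to the control qubit. -/
noncomputable def twist (lam : Circle) (φ : QState (Option (Fin n))) : QState (Option (Fin n)) :=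
  WithLp.toLp 2 fun a => (if a none then (lam⁻¹ : Circle) else lam : Circle) *
    φ (update a none (!a none))

/-- The step that applies `twist` under the control of a phase qubit. -/
noncomputable def twistGate (lam : Circle) (j : Fin k) : Gate (EstimatorWire n k) n b :=
  monomialGate ![Sum.inr j, Sum.inl (Sum.inl none)]
    (Involutive.toPerm (fun w => update w 1 (xor (w 1) (w 0))) fun w => by
      funext i
      fin_cases i <;> simp [update])
    fun w => if w 0 then (if w 1 then lam⁻¹ else lam) else 1

/-- The circuit that applies `groverMap` under the control of a phase qubit. -/
noncomputable def groverCircuit (lam : Circle) (j : Fin k) : Circuit (EstimatorWire n k) n b :=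
  twistGate lam j :: (Circuit.relabel pairEmbedding (Circuit.inv preparePair) ++
    (signFlip (fun i => Sum.inl (Sum.inl i)) (fun i => Sum.inl (Sum.inr i)) (Sum.inr j)
      (Finset.univ : Finset (Option (Fin n))).toList ++
      Circuit.relabel pairEmbedding preparePair))

variable (U V : QUnitary (Fin n)) (f : ℂ → Bits (Fin b))

/-- The product of a reflection at the pair of the prepared states and of `twist`. -/
noncomputable def groverMap (lam : Circle) (φ : QState (Option (Fin n))) :
    QState (Option (Fin n)) :=
  Circuit.run U V f preparePair
    (flipZero (Circuit.run U V f (Circuit.inv preparePair) (twist lam φ)))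

lemma bundle_apply (F : Bits (Fin k) → QState (Option (Fin n))) (z : Bits (EstimatorWire n k)) :
    bundle F z = if ∀ i, z (Sum.inl (Sum.inr i)) = false then
      F (fun j => z (Sum.inr j)) (fun i => z (Sum.inl (Sum.inl i))) else 0 := rfl

lemma run_relabel_bundle (c : Circuit (Option (Fin n)) n b)
    (F : Bits (Fin k) → QState (Option (Fin n))) :
    (c.relabel pairEmbedding).run U V f (bundle F) = bundle fun p => c.run U V f (F p) := by
  ext z
  rw [Circuit.run_relabel_apply]
  have h1 : ∀ (a : Bits (Option (Fin n))) i,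
      extend (pairEmbedding (k := k)) a z (Sum.inl (Sum.inr i)) = z (Sum.inl (Sum.inr i)) :=
    fun a i => extend_apply' _ _ _ (by rintro ⟨j, hj⟩; simp [pairEmbedding] at hj)
  have h2 : ∀ (a : Bits (Option (Fin n))) i,
      extend (pairEmbedding (k := k)) a z (Sum.inr i) = z (Sum.inr i) :=
    fun a i => extend_apply' _ _ _ (by rintro ⟨j, hj⟩; simp [pairEmbedding] at hj)
  have h3 : ∀ (a : Bits (Option (Fin n))) i,
      extend (pairEmbedding (k := k)) a z (Sum.inl (Sum.inl i)) = a i :=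
    fun a i => (pairEmbedding (k := k)).injective.extend_apply a z i
  have : slice pairEmbedding z (bundle F) =
      (if ∀ i, z (Sum.inl (Sum.inr i)) = false then (1 : ℂ) else 0) •
        F (fun j => z (Sum.inr j)) := by
    ext a
    simp only [slice_apply, bundle_apply, h1, h2, h3]
    split_ifs with h <;> simp
  rw [this, Circuit.run_smul, bundle_apply]
  split_ifs with h
  · rw [one_smul]; rfl
  · rw [zero_smul]; rfl

lemma twistGate_run_bundle (lam : Circle) (j : Fin k)
    (F : Bits (Fin k) → QState (Option (Fin n))) :
    (twistGate lam j : Gate _ n b).run U V f (bundle F) =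
      bundle fun p => if p j then twist lam (F p) else F p := by
  ext z
  have hv : Injective ![(Sum.inr j : EstimatorWire n k), Sum.inl (Sum.inl none)] := by
    intro i j hij
    fin_cases i <;> fin_cases j <;> simp_all
  rw [twistGate, monomialGate_run U V f _ _ _ (by norm_num) hv (bundle F) z
    (update z (Sum.inl (Sum.inl none)) (xor (z (Sum.inl (Sum.inl none))) (z (Sum.inr j))))]
  · have hupd : ∀ c, (fun i => update z (Sum.inl (Sum.inl none)) c (Sum.inl (Sum.inl i))) =
        update (fun i => z (Sum.inl (Sum.inl i))) none c := by
      intro c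
      funext i
      cases i <;> simp [update]
    simp only [bundle_apply, hupd]
    simp only [ne_eq, reduceCtorEq, not_false_eq_true, update_of_ne, Sum.inl.injEq]
    by_cases h : ∀ i, z (Sum.inl (Sum.inr i)) = false
    · rw [if_pos h, if_pos h]
      by_cases hj : z (Sum.inr j) = true
      · by_cases hc : z (Sum.inl (Sum.inl none)) = true <;> simp [twist, hj, hc]
      · simp [hj]
    · rw [if_neg h, if_neg h, mul_zero]
  · intro i
    change _ = update (fun i => z (![Sum.inr j, Sum.inl (Sum.inl none)] i)) 1
      (xor (z (Sum.inl (Sum.inl none))) (z (Sum.inr j))) i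
    fin_cases i <;> simp
  · intro i hi
    exact update_of_ne (hi 1).symm _ _

lemma signFlip_run_bundle (j : Fin k) (F : Bits (Fin k) → QState (Option (Fin n))) :
    (signFlip (fun i => Sum.inl (Sum.inl i)) (fun i => Sum.inl (Sum.inr i)) (Sum.inr j)
      (Finset.univ : Finset (Option (Fin n))).toList : Circuit _ n b).run U V f (bundle F) =
      bundle fun p => if p j then flipZero (F p) else F p := by
  ext z
  have hanc : Injective (fun i => (Sum.inl (Sum.inr i) : EstimatorWire n k)) :=
    fun i j h => by simpa using h
  rw [signFlip_run U V f hanc (by simp) _ (by simp) _ (Finset.nodup_toList _) (by simp),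
    bundle_apply, bundle_apply]
  split_ifs with h h' <;> [skip; skip; simp]
  · rw [signFlipPhase_eq hanc (by simp) _ _ (Finset.nodup_toList _) _ (fun i _ => h i)]
    simp [flipZero, h']
  · rw [signFlipPhase_eq hanc (by simp) _ _ (Finset.nodup_toList _) _ (fun i _ => h i)]
    simp [h']

/-- Only `twist` and the sign flip need the control by the phase qubit: when it is 0, the inverse
preparation and the preparation cancel. -/
lemma groverCircuit_run_bundle (lam : Circle) (j : Fin k)
    (F : Bits (Fin k) → QState (Option (Fin n))) :
    (groverCircuit lam j : Circuit _ n b).run U V f (bundle F) =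
      bundle fun p => if p j then groverMap U V f lam (F p) else F p := by
  simp only [groverCircuit, Circuit.run_cons, Circuit.run_append, twistGate_run_bundle,
    run_relabel_bundle, signFlip_run_bundle]
  congr 1
  funext p
  split_ifs
  · rfl
  · rw [Circuit.run_run_inv]

lemma groverCircuit_time (lam : Circle) (j : Fin k) (T : ℕ) :
    (groverCircuit lam j : Circuit (EstimatorWire n k) n b).time T = 4 * T + 2 * n + 8 := by
  simp only [groverCircuit, Circuit.time_cons, Circuit.time_append, Circuit.time_relabel,
    Circuit.time_inv, preparePair_time, signFlip_time, twistGate, monomialGate, localGate_time,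
    Finset.length_toList, Finset.card_univ, Fintype.card_option, Fintype.card_fin]
  ring

/-- Repeat a circuit. -/
def Circuit.repeated {ι : Type} (m : ℕ) (c : Circuit ι n b) : Circuit ι n b :=
  (List.replicate m c).flatten

lemma Circuit.repeated_time {ι : Type} (m : ℕ) (c : Circuit ι n b) (T : ℕ) :
    (c.repeated m).time T = m * c.time T := by
  induction m with
  | zero => simp [Circuit.repeated, Circuit.time_nil]
  | succ m ih =>
    have : c.repeated (m + 1) = c ++ c.repeated m := by
      simp [Circuit.repeated, List.replicate_succ]
    rw [this, Circuit.time_append, ih]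
    ring

lemma groverCircuit_repeated_run_bundle (lam : Circle) (j : Fin k) (m : ℕ)
    (F : Bits (Fin k) → QState (Option (Fin n))) :
    ((groverCircuit lam j : Circuit _ n b).repeated m).run U V f (bundle F) =
      bundle fun p => if p j then (groverMap U V f lam)^[m] (F p) else F p := by
  induction m generalizing F with
  | zero => simp [Circuit.repeated, Circuit.run_nil]
  | succ m ih =>
    have : (groverCircuit lam j : Circuit _ n b).repeated (m + 1) =
        groverCircuit lam j ++ (groverCircuit lam j : Circuit _ n b).repeated m := by
      simp [Circuit.repeated, List.replicate_succ]
    rw [this, Circuit.run_append, groverCircuit_run_bundle, ih]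
    congr 1
    funext p
    split_ifs <;> rfl

lemma hadamard_run_bundle (j : Fin k) (F : Bits (Fin k) → QState (Option (Fin n))) :
    (hadamard (Sum.inr j) : Gate (EstimatorWire n k) n b).run U V f (bundle F) =
      bundle fun p => ((1 / √2 : ℝ) : ℂ) •
        (F (update p j false) + (if p j then (-1 : ℂ) else 1) • F (update p j true)) := by
  ext z
  rw [hadamard_run]
  have hupd : ∀ c, (fun i => update z (Sum.inr j) c (Sum.inr i)) =
      update (fun i => z (Sum.inr i)) j c := by
    intro c
    funext i
    by_cases h : i = j <;> simp [h]
  simp only [bundle_apply, hupd]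
  simp only [ne_eq, reduceCtorEq, not_false_eq_true, update_of_ne]
  split_ifs <;> simp [mul_add]

/-- The step that multiplies `|1⟩|1⟩` by a phase. -/
noncomputable def phaseGate (s : Circle) (i j : Fin k) : Gate (EstimatorWire n k) n b :=
  monomialGate ![Sum.inr i, Sum.inr j] 1 fun w => if w 0 && w 1 then s else 1

lemma phaseGate_run_bundle (s : Circle) (i j : Fin k) (hij : i ≠ j)
    (F : Bits (Fin k) → QState (Option (Fin n))) :
    (phaseGate s i j : Gate (EstimatorWire n k) n b).run U V f (bundle F) =
      bundle fun p => (if p i && p j then (s : ℂ) else 1) • F p := by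
  ext z
  have hv : Injective ![(Sum.inr i : EstimatorWire n k), Sum.inr j] := by
    intro i j hij
    fin_cases i <;> fin_cases j <;> simp_all
  rw [phaseGate, monomialGate_run U V f _ _ _ (by norm_num) hv (bundle F) z z (by simp) (by simp)]
  simp only [bundle_apply]
  split_ifs <;> simp_all

end Grover

/-! ### Phase estimation -/

section PhaseEstimation

variable {n b k : ℕ}

/-- The natural number with the given binary digits. -/
def bitsValue (p : Bits (Fin k)) : ℕ := ∑ i : Fin k, if p i then 2 ^ (i : ℕ) else 0

/-- The root of unity `exp(-2πi/2^k)`. -/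
noncomputable def rootInv (k : ℕ) : Circle := Circle.exp (-(2 * Real.pi / 2 ^ k))

lemma rootInv_pow_two_pow (k : ℕ) : rootInv k ^ 2 ^ k = 1 := by
  rw [rootInv, ← Circle.exp_natCast_mul]
  push_cast
  rw [mul_neg, mul_div_cancel₀ _ (by positivity), Circle.exp_neg, Circle.exp_two_pi, inv_one]

lemma coe_rootInv_pow_two_pow_pred (hk : 0 < k) : ((rootInv k : Circle) : ℂ) ^ 2 ^ (k - 1) = -1 := by
  obtain ⟨m, rfl⟩ : ∃ m, k = m + 1 := ⟨k - 1, by omega⟩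
  rw [← Circle.coe_pow, rootInv, ← Circle.exp_natCast_mul]
  have : ((2 ^ (m + 1 - 1) : ℕ) : ℝ) * -(2 * Real.pi / 2 ^ (m + 1)) = -Real.pi := by
    push_cast
    rw [pow_succ]
    field_simp
  rw [this, Circle.coe_exp]
  push_cast
  rw [neg_mul, Complex.exp_neg, Complex.exp_pi_mul_I]
  norm_num

/-- The `j`-th round of the phase estimation. -/
noncomputable def estimationRound (lam : Circle) (j : Fin k) : Circuit (EstimatorWire n k) n b :=
  hadamard (Sum.inr j) :: (Circuit.repeated (2 ^ (k - 1 - j)) (groverCircuit lam j) ++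
    (((Finset.univ.erase j : Finset (Fin k)).toList.map fun i : Fin k =>
      phaseGate (rootInv k ^ 2 ^ ((i : ℕ) + (k - 1 - j))) i j)
      ++ [hadamard (Sum.inr j)]))

/-- The amplitude of the outcome `z` of the phase estimation for the eigenvalue `μ`. -/
noncomputable def estimationAmplitude (k : ℕ) (μ : ℂ) (z : ℕ) : ℂ :=
  ∏ i ∈ Finset.range k, (1 + (μ * (rootInv k : ℂ) ^ z) ^ 2 ^ (k - 1 - i)) / 2

/-- Phase estimation for `groverMap`, applied to the pair of the prepared states. -/
noncomputable def estimator (lam : Circle) : Circuit (EstimatorWire n k) n b :=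
  Circuit.relabel pairEmbedding preparePair ++ (List.finRange k).flatMap (estimationRound lam)

lemma bitsValue_update_false (p : Bits (Fin k)) (j : Fin k) :
    bitsValue p = bitsValue (update p j false) + if p j then 2 ^ (j : ℕ) else 0 := by
  simp only [bitsValue]
  rw [← Finset.add_sum_erase _ _ (Finset.mem_univ j),
    ← Finset.add_sum_erase _ (fun i => if update p j false i = true then 2 ^ (i : ℕ) else 0)
      (Finset.mem_univ j)]
  simp only [update_self, Bool.false_eq_true, if_false, zero_add]
  rw [add_comm]
  congr 1
  refine Finset.sum_congr rfl fun i hi => ?_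
  rw [update_of_ne (Finset.ne_of_mem_erase hi)]

lemma rootInv_pow_bitsValue (p : Bits (Fin k)) (m : ℕ) :
    ((rootInv k : ℂ) ^ bitsValue p) ^ m =
      ∏ i : Fin k, if p i then (rootInv k : ℂ) ^ (2 ^ (i : ℕ) * m) else 1 := by
  rw [bitsValue, ← pow_mul, Finset.sum_mul, ← Finset.prod_pow_eq_pow_sum]
  refine Finset.prod_congr rfl fun i _ => ?_
  split_ifs <;> simp

variable (U V : QUnitary (Fin n)) (f : ℂ → Bits (Fin b))

lemma run_phaseGates_bundle (s : Fin k → Circle) (j : Fin k) (L : List (Fin k))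
    (hL : ∀ i ∈ L, i ≠ j) (F : Bits (Fin k) → QState (Option (Fin n))) :
    Circuit.run U V f (L.map fun i => (phaseGate (s i) i j : Gate (EstimatorWire n k) n b))
      (bundle F) =
      bundle fun p => (if p j then (L.map fun i => if p i then (s i : ℂ) else 1).prod else 1) •
        F p := by
  induction L generalizing F with
  | nil => simp [Circuit.run_nil]
  | cons i L ih =>
    rw [List.map_cons, Circuit.run_cons, phaseGate_run_bundle U V f _ _ _ (hL i (by simp)),
      ih fun i hi => hL i (by simp [hi])]
    congr 1
    funext p
    rw [smul_smul]
    congr 1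
    by_cases hi : p i = true <;> by_cases hj : p j = true <;> simp [hi, hj, mul_comm]

lemma groverMap_smul (lam : Circle) (c : ℂ) (φ : QState (Option (Fin n))) :
    groverMap U V f lam (c • φ) = c • groverMap U V f lam φ := by
  have h1 : twist lam (c • φ) = c • twist lam φ := by
    ext a
    simp only [twist, PiLp.smul_apply, smul_eq_mul]
    ring
  have h2 : ∀ φ : QState (Option (Fin n)), flipZero (c • φ) = c • flipZero φ := by
    intro φ
    ext a
    simp only [flipZero, PiLp.smul_apply, smul_eq_mul]
    split_ifs <;> ring
  rw [groverMap, h1, Circuit.run_smul, h2, Circuit.run_smul, groverMap]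

lemma groverMap_iterate_smul {lam : Circle} {μ : ℂ} {v : QState (Option (Fin n))}
    (hv : groverMap U V f lam v = μ • v) (m : ℕ) (c : ℂ) :
    (groverMap U V f lam)^[m] (c • v) = (c * μ ^ m) • v := by
  induction m generalizing c with
  | zero => simp
  | succ m ih =>
    rw [iterate_succ_apply, groverMap_smul, hv, smul_smul, ih]
    congr 1
    ring

/-- The hypothesis `hg` says that phase qubit `j` is still 0, so the first Hadamard gives an even
superposition. The branch 1 then collects a power of `μ` and, from the phase gates, the
contributions of all other bits to the power of `rootInv k ^ bitsValue p`. The contribution of bit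
`j` itself is -1, which is exactly the sign in the second Hadamard. -/
lemma estimationRound_run {lam : Circle} {μ : ℂ} {v : QState (Option (Fin n))}
    (hv : groverMap U V f lam v = μ • v) (j : Fin k) (g : Bits (Fin k) → ℂ)
    (hg : ∀ p, p j = true → g p = 0) :
    (estimationRound lam j : Circuit _ n b).run U V f (bundle fun p => g p • v) =
      bundle fun p => (g (update p j false) *
        ((1 + (μ * (rootInv k : ℂ) ^ bitsValue p) ^ 2 ^ (k - 1 - j : ℕ)) / 2)) • v := by
  have hs : ((1 / √2 : ℝ) : ℂ) * ((1 / √2 : ℝ) : ℂ) = 1 / 2 := by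
    rw [← Complex.ofReal_mul, div_mul_div_comm, Real.mul_self_sqrt zero_le_two, one_mul]
    norm_num
  set s : ℂ := ((1 / √2 : ℝ) : ℂ)
  have h1 : (fun p : Bits (Fin k) => s • (g (update p j false) • v +
      (if p j then (-1 : ℂ) else 1) • g (update p j true) • v)) =
      fun p => (s * g (update p j false)) • v := by
    funext p
    rw [hg (update p j true) (by simp), zero_smul, smul_zero, add_zero, smul_smul]
  rw [estimationRound, Circuit.run_cons, hadamard_run_bundle, h1, Circuit.run_append,
    groverCircuit_repeated_run_bundle, Circuit.run_append,
    run_phaseGates_bundle U V f _ _ _ (by simp), Circuit.run_cons, hadamard_run_bundle,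
    Circuit.run_nil]
  congr 1
  funext p
  simp only [groverMap_iterate_smul U V f hv, update_self, update_idem, if_true,
    Bool.false_eq_true, if_false, smul_smul, ← add_smul]
  congr 1
  rw [Finset.prod_map_toList, mul_pow, rootInv_pow_bitsValue,
    ← Finset.mul_prod_erase _ _ (Finset.mem_univ j)]
  have h2 : ∏ i ∈ Finset.univ.erase j, (if update p j true i = true then
      ((rootInv k ^ 2 ^ ((i : ℕ) + (k - 1 - j)) : Circle) : ℂ) else 1) =
      ∏ i ∈ Finset.univ.erase j,
        if p i then (rootInv k : ℂ) ^ (2 ^ (i : ℕ) * 2 ^ (k - 1 - j : ℕ)) else 1 := by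
    refine Finset.prod_congr rfl fun i hi => ?_
    rw [update_of_ne (Finset.ne_of_mem_erase hi), Circle.coe_pow, pow_add]
  have h3 : (rootInv k : ℂ) ^ (2 ^ (j : ℕ) * 2 ^ (k - 1 - j : ℕ)) = -1 := by
    rw [← pow_add, show (j : ℕ) + (k - 1 - j) = k - 1 by omega]
    exact coe_rootInv_pow_two_pow_pred (by have := j.2; omega)
  rw [h2, h3]
  linear_combination (g (update p j false) * (1 + (if p j then (-1 : ℂ) else 1) *
    (∏ i ∈ Finset.univ.erase j,
        if p i then (rootInv k : ℂ) ^ (2 ^ (i : ℕ) * 2 ^ (k - 1 - j : ℕ)) else 1) *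
          μ ^ 2 ^ (k - 1 - j : ℕ))) * hs

/-- The bits are found from the least significant one upwards. Phase gates controlled by qubits not
yet treated are harmless, because those qubits are still 0. -/
lemma estimationRounds_run {lam : Circle} {μ : ℂ} {v : QState (Option (Fin n))}
    (hv : groverMap U V f lam v = μ • v) (m : ℕ) (hm : m ≤ k) :
    Circuit.run U V f (((List.finRange k).take m).flatMap (estimationRound lam) : Circuit _ n b)
      (bundle fun p => (if ∀ i, p i = false then (1 : ℂ) else 0) • v) =
      bundle fun p => ((if ∀ i : Fin k, m ≤ i → p i = false then (1 : ℂ) else 0) *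
        ∏ i ∈ Finset.range m,
          (1 + (μ * (rootInv k : ℂ) ^ bitsValue p) ^ 2 ^ (k - 1 - i)) / 2) • v := by
  induction m with
  | zero => simp [Circuit.run_nil]
  | succ m ih =>
    have hm' : m < (List.finRange k).length := by simpa using hm
    rw [List.take_succ_eq_append_getElem hm', List.flatMap_append, Circuit.run_append,
      ih (by omega), List.flatMap_singleton, List.getElem_finRange]
    set j : Fin k := Fin.cast (by simp) ⟨m, hm'⟩ with hj
    have hjm : (j : ℕ) = m := rfl
    rw [estimationRound_run U V f hv j]
    · congr 1
      funext p
      congr 1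
      rw [Finset.prod_range_succ, hjm, ← mul_assoc]
      congr 1
      congr 1
      · refine if_congr ⟨fun h i hi => ?_, fun h i hi => ?_⟩ rfl rfl
        · have := h i (by omega)
          rwa [update_of_ne] at this
          rintro rfl
          omega
        · by_cases hij : i = j
          · simp [hij]
          · rw [update_of_ne hij]
            refine h i ?_
            have : (i : ℕ) ≠ m := fun h => hij (Fin.ext h)
            omega
      · refine Finset.prod_congr rfl fun i hi => ?_
        congr 2
        -- Setting bit `j` does not change the factors of earlier rounds `i < j`: it changes the
        -- exponent of the root of unity by `2 ^ (j + k - 1 - i)`, a multiple of its order `2 ^ k`.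
        rw [mul_pow, mul_pow, bitsValue_update_false p j]
        congr 1
        split_ifs
        · rw [pow_add, mul_pow, ← pow_mul _ (2 ^ _), ← pow_add]
          have hi' := Finset.mem_range.1 hi
          rw [show (j : ℕ) + (k - 1 - i) = k + (m - 1 - i) by omega, pow_add 2, pow_mul,
            ← Circle.coe_pow (rootInv k) (2 ^ k), rootInv_pow_two_pow]
          simp
        · simp
    · intro p hp
      rw [if_neg, zero_mul]
      intro h
      rw [h j hjm.ge] at hp
      exact Bool.false_ne_true hp

lemma bundle_add (F G : Bits (Fin k) → QState (Option (Fin n))) :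
    bundle (fun p => F p + G p) = bundle F + bundle G := by
  ext z
  simp only [bundle_apply, PiLp.add_apply]
  split_ifs <;> simp

lemma zeroState_estimator : zeroState (EstimatorWire n k) =
    bundle fun p => (if ∀ i, p i = false then (1 : ℂ) else 0) • zeroState (Option (Fin n)) := by
  ext z
  simp only [bundle_apply, zeroState, PiLp.smul_apply, smul_eq_mul]
  simp only [Sum.forall]
  split_ifs <;> simp_all

/-- The rounds are linear, so it suffices to follow the two eigenvectors separately; neither
orthogonality nor normalization is needed. -/
lemma estimator_run {x y : QState (Fin n)} (hx : Prepares U x) (hy : Prepares V y)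
    {lam : Circle} {μ μ' : ℂ} {v v' : QState (Option (Fin n))}
    (hv : groverMap U V f lam v = μ • v) (hv' : groverMap U V f lam v' = μ' • v')
    (hsum : pairVector x y = v + v') :
    (estimator lam : Circuit (EstimatorWire n k) n b).run U V f (zeroState _) =
      bundle fun p => estimationAmplitude k μ (bitsValue p) • v +
        estimationAmplitude k μ' (bitsValue p) • v' := by
  have key : ∀ {μ : ℂ} {v : QState (Option (Fin n))}, groverMap U V f lam v = μ • v →
      Circuit.run U V f ((List.finRange k).flatMap (estimationRound lam) : Circuit _ n b)
        (bundle fun p => (if ∀ i, p i = false then (1 : ℂ) else 0) • v) =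
      bundle fun p => estimationAmplitude k μ (bitsValue p) • v := by
    intro μ v hv
    have := estimationRounds_run (b := b) U V f hv k le_rfl
    rw [List.take_of_length_le (by simp)] at this
    rw [this]
    congr 1
    funext p
    rw [if_pos fun i hi => absurd i.2 (by omega), one_mul]
    rfl
  rw [estimator, Circuit.run_append, zeroState_estimator, run_relabel_bundle]
  simp only [Circuit.run_smul, preparePair_run U V f hx hy, hsum, smul_add]
  rw [bundle_add, Circuit.run_add, key hv, key hv', bundle_add]

lemma estimationRound_time (lam : Circle) (j : Fin k) (T : ℕ) :
    (estimationRound lam j : Circuit (EstimatorWire n k) n b).time T =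
      2 ^ (k - 1 - j : ℕ) * (4 * T + 2 * n + 8) + k + 1 := by
  have h : ∀ (s : Fin k → Circle) (L : List (Fin k)), Circuit.time T
      (L.map fun i => (phaseGate (s i) i j : Gate (EstimatorWire n k) n b)) = L.length := by
    intro s L
    induction L with
    | nil => rfl
    | cons i L ih =>
      rw [List.map_cons, Circuit.time_cons, ih, phaseGate, monomialGate, localGate_time,
        List.length_cons, add_comm]
  have hk := j.2
  rw [estimationRound, Circuit.time_cons, Circuit.time_append, Circuit.time_append,
    Circuit.repeated_time, groverCircuit_time, h, Circuit.time_cons, Circuit.time_nil, hadamard,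
    localGate_time, Finset.length_toList, Finset.card_erase_of_mem (Finset.mem_univ j),
    Finset.card_univ, Fintype.card_fin]
  omega

lemma estimator_time_le (lam : Circle) (T : ℕ) (hT : 1 ≤ T) (hnT : n ≤ T) :
    (estimator lam : Circuit (EstimatorWire n k) n b).time T ≤ 24 * (T * 2 ^ k) := by
  have h1 : ∀ L : List (Fin k), Circuit.time T
      (L.flatMap (estimationRound lam) : Circuit (EstimatorWire n k) n b) =
      (L.map fun j : Fin k => 2 ^ (k - 1 - j : ℕ) * (4 * T + 2 * n + 8) + k + 1).sum := by
    intro L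
    induction L with
    | nil => rfl
    | cons i L ih =>
      rw [List.flatMap_cons, Circuit.time_append, ih, estimationRound_time, List.map_cons,
        List.sum_cons]
  have h2 : ∑ j : Fin k, 2 ^ (k - 1 - j : ℕ) ≤ 2 ^ k := by
    rw [Fin.sum_univ_eq_sum_range (fun j => 2 ^ (k - 1 - j)) k,
      Finset.sum_range_reflect (fun j => 2 ^ j) k]
    have := Nat.geomSum_lt (m := 2) (n := k) (s := Finset.range k) le_rfl (by simp)
    exact this.le
  have h3 : ∀ k : ℕ, k * (k + 1) ≤ 6 * 2 ^ k := by
    intro k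
    induction k with
    | zero => simp
    | succ k ih =>
      have h4 : k + 1 ≤ 2 ^ k := Nat.lt_two_pow_self
      rw [pow_succ]
      nlinarith
  rw [estimator, Circuit.time_append, Circuit.time_relabel, preparePair_time, h1,
    ← List.ofFn_eq_map, List.sum_ofFn]
  simp only [add_assoc]
  rw [Finset.sum_add_distrib, ← Finset.sum_mul]
  simp only [Finset.sum_const, Finset.card_univ, Fintype.card_fin, smul_eq_mul]
  -- The constant 24 is 14 for the controlled products, 6 for the k(k + 1) remaining steps (`h3`),
  -- and 4 for the initial preparation of time 2T + 2 ≤ 4T.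
  have h5 : (∑ j : Fin k, 2 ^ (k - 1 - j : ℕ)) * (4 * T + (2 * n + 8)) ≤ 2 ^ k * (14 * T) :=
    Nat.mul_le_mul h2 (by omega)
  have h6 : T ≤ T * 2 ^ k := Nat.le_mul_of_pos_right _ (by positivity)
  have h7 : 2 ^ k ≤ T * 2 ^ k := Nat.le_mul_of_pos_left _ hT
  have h8 := h3 k
  nlinarith

end PhaseEstimation

/-! ### Eigenvectors of a product of two reflections -/

section Eigenvectors

variable {E : Type} [NormedAddCommGroup E] [InnerProductSpace ℂ E]

/-- In the coordinates (α, β), `Q` has characteristic polynomial μ² - 2dμ + 1, and (μ, -1) is an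
eigenvector. The normalization by 2i Im μ makes the eigenvectors of μ and of its conjugate add up to
ψ. -/
lemma eigenvector_of_recurrence {Q : E → E} {ψ χ : E} {d : ℝ} (hψ : ‖ψ‖ = 1) (hχ : ‖χ‖ = 1)
    (hd : inner ℂ ψ χ = (d : ℂ))
    (hQ : ∀ α β : ℂ, Q (α • ψ + β • χ) = (2 * d * α + β) • ψ + (-α) • χ) {μ : ℂ} (hμ : ‖μ‖ = 1)
    (hre : μ.re = d) (him : μ.im ≠ 0) :
    Q ((μ / (2 * μ.im * Complex.I)) • ψ + (-1 / (2 * μ.im * Complex.I)) • χ) =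
      μ • ((μ / (2 * μ.im * Complex.I)) • ψ + (-1 / (2 * μ.im * Complex.I)) • χ) ∧
    ‖(μ / (2 * μ.im * Complex.I)) • ψ + (-1 / (2 * μ.im * Complex.I)) • χ‖ ≤ 1 := by
  have hsq : μ.re ^ 2 + μ.im ^ 2 = 1 := by
    have := Complex.sq_norm μ
    rw [hμ, Complex.normSq_apply] at this
    nlinarith
  rw [hre] at hsq
  have hdisc : 2 * (d : ℂ) * μ - 1 = μ ^ 2 := by
    apply Complex.ext
    · simp [pow_two, hre]
      nlinarith
    · simp [pow_two, hre]
      ring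
  have him' : (μ.im : ℂ) ≠ 0 := by exact_mod_cast him
  have hI := Complex.I_ne_zero
  constructor
  · rw [hQ, smul_add, smul_smul, smul_smul]
    congr 2
    · field_simp
      linear_combination hdisc
    · field_simp
  · have h1 : (μ / (2 * μ.im * Complex.I)) • ψ + (-1 / (2 * μ.im * Complex.I)) • χ =
        (1 / (2 * μ.im * Complex.I)) • (μ • ψ - χ) := by
      rw [smul_sub, smul_smul, sub_eq_add_neg, ← neg_smul]
      congr 2 <;> ring
    have h2 : ‖μ • ψ - χ‖ ^ 2 = 2 * μ.im ^ 2 := by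
      rw [norm_sub_sq (𝕜 := ℂ), norm_smul, hμ, hψ, hχ, inner_smul_left, hd]
      simp [hre]
      nlinarith
    have h3 : ‖(1 / (2 * μ.im * Complex.I) : ℂ)‖ ^ 2 = 1 / (4 * μ.im ^ 2) := by
      simp only [norm_div, norm_mul, norm_one, Complex.norm_I, Complex.norm_real, Complex.norm_two,
        Real.norm_eq_abs, mul_one, div_pow, mul_pow, sq_abs, one_pow]
      norm_num
    rw [h1]
    have h4 : ‖(1 / (2 * μ.im * Complex.I) : ℂ) • (μ • ψ - χ)‖ ^ 2 = 1 / 2 := by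
      rw [norm_smul, mul_pow, h2, h3]
      field_simp
      norm_num
    nlinarith [norm_nonneg ((1 / (2 * μ.im * Complex.I) : ℂ) • (μ • ψ - χ))]

lemma exists_eigenvectors_of_recurrence {Q : E → E} {ψ χ : E} {d : ℝ} (hψ : ‖ψ‖ = 1)
    (hχ : ‖χ‖ = 1) (hd : inner ℂ ψ χ = (d : ℂ))
    (hQ : ∀ α β : ℂ, Q (α • ψ + β • χ) = (2 * d * α + β) • ψ + (-α) • χ) :
    ∃ (μ : ℂ) (v v' : E), ‖μ‖ = 1 ∧ μ.re = d ∧ Q v = μ • v ∧ Q v' = (starRingEnd ℂ μ) • v' ∧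
      ψ = v + v' ∧ ‖v‖ ≤ 1 ∧ ‖v'‖ ≤ 1 := by
  have hd1 : d ^ 2 ≤ 1 := by
    have := norm_inner_le_norm (𝕜 := ℂ) ψ χ
    rw [hd, hψ, hχ, Complex.norm_real, mul_one] at this
    exact (sq_le_one_iff_abs_le_one d).2 this
  rcases hd1.eq_or_lt with h | h
  -- For d = ±1 the two eigenvalues coincide and the normalization breaks down. By the equality case
  -- of Cauchy–Schwarz, ψ and χ are then parallel, and ψ is itself an eigenvector.
  · have hχ' : χ = (d : ℂ) • ψ := by
      rw [← sub_eq_zero, ← norm_eq_zero, ← sq_eq_zero_iff, norm_sub_sq (𝕜 := ℂ), norm_smul, hψ, hχ,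
        inner_smul_right, ← inner_conj_symm, hd]
      simp
      nlinarith
    have h0 := hQ 1 0
    have h00 := hQ 0 0
    refine ⟨d, ψ, 0, ?_, by simp, ?_, ?_, by simp, hψ.le, by simp⟩
    · rw [Complex.norm_real]
      exact (pow_eq_one_iff_of_nonneg (norm_nonneg d) two_ne_zero).1 (by rw [Real.norm_eq_abs, sq_abs, h])
    · rw [one_smul, zero_smul, add_zero] at h0
      rw [h0, hχ']
      module
    · simpa using h00
  · have hs : 0 < √(1 - d ^ 2) := Real.sqrt_pos.2 (by linarith)
    set μ : ℂ := ⟨d, √(1 - d ^ 2)⟩ with hμdef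
    have hμ : ‖μ‖ = 1 := by
      rw [← pow_eq_one_iff_of_nonneg (norm_nonneg _) two_ne_zero, Complex.sq_norm, Complex.normSq_mk,
        Real.mul_self_sqrt (by linarith)]
      ring
    have him : μ.im ≠ 0 := hs.ne'
    have e1 := eigenvector_of_recurrence hψ hχ hd hQ hμ rfl him
    have e2 := eigenvector_of_recurrence hψ hχ hd hQ (μ := starRingEnd ℂ μ)
      (by rw [RCLike.norm_conj, hμ]) rfl (by simpa using him)
    refine ⟨μ, _, _, hμ, rfl, e1.1, e2.1, ?_, e1.2, e2.2⟩
    have him' : (μ.im : ℂ) ≠ 0 := by exact_mod_cast him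
    have hI := Complex.I_ne_zero
    have h1 : μ / (2 * μ.im * Complex.I) + (starRingEnd ℂ μ) /
        (2 * (starRingEnd ℂ μ).im * Complex.I) = 1 := by
      have h2 : μ - starRingEnd ℂ μ = 2 * μ.im * Complex.I := by
        rw [Complex.sub_conj]
        push_cast
        ring
      rw [Complex.conj_im, Complex.ofReal_neg, show 2 * -(μ.im : ℂ) * Complex.I =
        -(2 * μ.im * Complex.I) by ring, div_neg, ← sub_eq_add_neg, ← sub_div, h2, div_self]
      exact mul_ne_zero (mul_ne_zero two_ne_zero him') hI
    have h2 : -1 / (2 * μ.im * Complex.I) + -1 / (2 * (starRingEnd ℂ μ).im * Complex.I) = 0 := by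
      rw [Complex.conj_im, Complex.ofReal_neg]
      field_simp
      ring
    rw [add_add_add_comm, ← add_smul, ← add_smul, h1, h2, one_smul, zero_smul, add_zero]

end Eigenvectors

/-! ### Spectrum of the Grover map on the pair state -/

section GroverSpectrum

variable {n b : ℕ} (U V : QUnitary (Fin n)) (f : ℂ → Bits (Fin b))

lemma inner_zeroState {κ : Type} [Fintype κ] [DecidableEq κ] (φ : QState κ) :
    inner ℂ (zeroState κ) φ = φ fun _ => false := by
  rw [PiLp.inner_apply, Finset.sum_eq_single fun _ => false]
  · simp [zeroState]
  · intro z _ hz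
    have : ¬ ∀ i, z i = false := fun h => hz (funext h)
    simp [zeroState, this]
  · simp

lemma norm_zeroState (κ : Type) [Fintype κ] [DecidableEq κ] : ‖zeroState κ‖ = 1 := by
  have h := inner_zeroState (zeroState κ)
  rw [inner_self_eq_norm_sq_to_K] at h
  have h' : ‖zeroState κ‖ ^ 2 = 1 := by
    have : zeroState κ (fun _ => false) = 1 := by simp [zeroState]
    rw [this] at h
    apply Complex.ofReal_injective
    simpa using h
  exact (pow_eq_one_iff_of_nonneg (norm_nonneg _) two_ne_zero).1 h'

lemma flipZero_eq {κ : Type} [Fintype κ] [DecidableEq κ] (φ : QState κ) :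
    flipZero φ = φ + (-2 * inner ℂ (zeroState κ) φ) • zeroState κ := by
  ext z
  rw [inner_zeroState]
  by_cases h : ∀ i, z i = false
  · have : z = fun _ => false := funext h
    subst this
    simp [flipZero, zeroState]
    ring
  · simp [flipZero, zeroState, h]

lemma groverMap_eq {x y : QState (Fin n)} (hx : Prepares U x) (hy : Prepares V y) (lam : Circle)
    (φ : QState (Option (Fin n))) :
    groverMap U V f lam φ =
      twist lam φ + (-2 * inner ℂ (pairVector x y) (twist lam φ)) • pairVector x y := by
  rw [groverMap, flipZero_eq, Circuit.run_add, Circuit.run_smul, Circuit.run_run_inv,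
    ← Circuit.inner_run, preparePair_run U V f hx hy]

lemma norm_pairVector {x y : QState (Fin n)} (hx : Prepares U x) (hy : Prepares V y) :
    ‖pairVector x y‖ = 1 := by
  rw [← preparePair_run (b := 0) U V (fun _ _ => false) hx hy, Circuit.norm_run, norm_zeroState]

lemma twist_add (lam : Circle) (φ χ : QState (Option (Fin n))) :
    twist lam (φ + χ) = twist lam φ + twist lam χ := by
  ext a
  simp only [twist, PiLp.add_apply]
  ring

lemma twist_smul (lam : Circle) (c : ℂ) (φ : QState (Option (Fin n))) :
    twist lam (c • φ) = c • twist lam φ := by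
  ext a
  simp only [twist, PiLp.smul_apply, smul_eq_mul]
  ring

lemma twist_twist (lam : Circle) (φ : QState (Option (Fin n))) :
    twist lam (twist lam φ) = φ := by
  ext a
  by_cases h : a none = true <;> simp [twist, h]

lemma norm_twist (lam : Circle) (φ : QState (Option (Fin n))) : ‖twist lam φ‖ = ‖φ‖ := by
  rw [EuclideanSpace.norm_eq, EuclideanSpace.norm_eq]
  congr 1
  have hinv : Involutive fun a : Bits (Option (Fin n)) => update a none (!a none) :=
    fun a => by simp
  refine Fintype.sum_equiv hinv.toPerm _ _ fun a => ?_
  simp only [twist, norm_mul, Circle.norm_coe, one_mul]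
  rfl

/-- Flipping the control pairs `x` with `y`: the two branches contribute λ⟨x|y⟩/2 and its conjugate.
-/
lemma inner_pairVector_twist (x y : QState (Fin n)) (lam : Circle) :
    inner ℂ (pairVector x y) (twist lam (pairVector x y)) = ((lam * inner ℂ x y : ℂ).re : ℂ) := by
  have hs : (starRingEnd ℂ ((1 / √2 : ℝ) : ℂ)) * ((1 / √2 : ℝ) : ℂ) = 1 / 2 := by
    rw [Complex.conj_ofReal, ← Complex.ofReal_mul, div_mul_div_comm, Real.mul_self_sqrt zero_le_two,
      one_mul]
    norm_num
  rw [Complex.re_eq_add_conj, map_mul, inner_conj_symm, ← Circle.coe_inv_eq_conj]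
  simp only [PiLp.inner_apply, RCLike.inner_apply]
  rw [← bitsOptionEquiv.symm.sum_comp, Fintype.sum_prod_type, Fintype.sum_bool, Finset.mul_sum,
    Finset.mul_sum, ← Finset.sum_add_distrib, ← Finset.sum_add_distrib, Finset.sum_div]
  refine Finset.sum_congr rfl fun a _ => ?_
  simp only [pairVector, twist, bitsOptionEquiv, Equiv.coe_fn_symm_mk, Option.elim]
  simp only [update_self, ne_eq, reduceCtorEq, not_false_eq_true, update_of_ne, map_mul]
  simp only [if_true, Bool.not_true, Bool.not_false, Bool.false_eq_true, if_false]
  linear_combination (starRingEnd ℂ (y a) * ((lam⁻¹ : Circle) : ℂ) * x a +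
    starRingEnd ℂ (x a) * lam * y a) * hs

lemma exists_groverMap_eigenvectors {x y : QState (Fin n)} (hx : Prepares U x) (hy : Prepares V y)
    (lam : Circle) :
    ∃ (μ : ℂ) (v v' : QState (Option (Fin n))), ‖μ‖ = 1 ∧ μ.re = -(lam * inner ℂ x y : ℂ).re ∧
      groverMap U V f lam v = μ • v ∧ groverMap U V f lam v' = (starRingEnd ℂ μ) • v' ∧
      pairVector x y = v + v' ∧ ‖v‖ ≤ 1 ∧ ‖v'‖ ≤ 1 := by
  have hψ := norm_pairVector U V hx hy
  have hin := inner_pairVector_twist x y lam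
  have h1 : inner ℂ (pairVector x y) (pairVector x y) = (1 : ℂ) := by
    rw [inner_self_eq_norm_sq_to_K, hψ]
    simp
  -- With χ = -Sψ, the relation S² = 1 gives Qψ = 2dψ - χ and Qχ = ψ, which is the recurrence.
  refine exists_eigenvectors_of_recurrence (ψ := pairVector x y)
    (χ := (-1 : ℂ) • twist lam (pairVector x y)) hψ ?_ ?_ fun α β => ?_
  · rw [norm_smul, norm_twist, hψ]
    simp
  · rw [inner_smul_right, hin]
    push_cast
    ring
  · rw [groverMap_eq U V f hx hy, twist_add, twist_smul, twist_smul, twist_smul, twist_twist,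
      inner_add_right, inner_smul_right, inner_smul_right, inner_smul_right, hin, h1]
    push_cast
    module

end GroverSpectrum

/-! ### Tail bound for phase estimation -/

section Tail

/-- Telescoping: 1/u² ≤ 1/(u - 1/2) - 1/(u + 1/2). The maximum with J keeps the telescoping function
positive and nonincreasing also below the threshold, and its first value is at most 1/(J - 1/2) ≤
2/J. -/
lemma sum_inv_sq_le (N : ℕ) (s : ℝ) {J : ℝ} (hJ : 1 ≤ J) :
    ∑ z ∈ Finset.range N, (if J ≤ z + s then 1 / (z + s) ^ 2 else 0) ≤ 2 / J := by
  set G : ℕ → ℝ := fun z => 1 / (max (z + s) J - 1 / 2) with hG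
  have hpos : ∀ z : ℕ, 0 < max (z + s) J - 1 / 2 := fun z => by
    have := le_max_right (z + s) J
    linarith
  have h1 : ∀ z ∈ Finset.range N, (if J ≤ z + s then 1 / (z + s) ^ 2 else 0) ≤ G z - G (z + 1) := by
    intro z _
    split_ifs with h
    · have h2 : max ((z : ℝ) + s) J = z + s := max_eq_left h
      have h3 : max (((z + 1 : ℕ) : ℝ) + s) J = z + s + 1 := by
        push_cast
        rw [max_eq_left (by linarith)]
        ring
      simp only [hG, h2, h3]
      rw [div_sub_div _ _ (by linarith) (by linarith), div_le_div_iff₀ (by nlinarith) (by nlinarith)]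
      nlinarith
    · rw [sub_nonneg]
      refine one_div_le_one_div_of_le (hpos z) ?_
      push_cast
      gcongr
      linarith
  refine (Finset.sum_le_sum h1).trans ?_
  rw [Finset.sum_range_sub']
  have h4 : 0 ≤ G N := (one_div_pos.2 (hpos N)).le
  have h5 : G 0 ≤ 2 / J := by
    have := le_max_right (((0 : ℕ) : ℝ) + s) J
    rw [hG]
    simp only
    rw [div_le_div_iff₀ (hpos 0) (by linarith)]
    generalize max (((0 : ℕ) : ℝ) + s) J = M at this ⊢
    linarith
  linarith

lemma sum_inv_sq_le' (N : ℕ) (s : ℝ) {J : ℝ} (hJ : 1 ≤ J) :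
    ∑ z ∈ Finset.range N, (if J ≤ s - z then 1 / (s - z) ^ 2 else 0) ≤ 2 / J := by
  rw [← Finset.sum_range_reflect]
  refine le_trans (le_of_eq (Finset.sum_congr rfl fun z hz => ?_))
    (sum_inv_sq_le N (s - (N - 1)) hJ)
  have hz' := Finset.mem_range.1 hz
  have : s - ((N - 1 - z : ℕ) : ℝ) = z + (s - (N - 1)) := by
    rw [Nat.cast_sub (by omega), Nat.cast_sub (by omega)]
    push_cast
    ring
  rw [this]

lemma prod_one_add_pow_mul (y : ℂ) (k : ℕ) :
    (∏ i ∈ Finset.range k, (1 + y ^ 2 ^ i)) * (y - 1) = y ^ 2 ^ k - 1 := by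
  induction k with
  | zero => simp
  | succ k ih =>
    rw [Finset.prod_range_succ, mul_right_comm, ih, pow_succ 2 k, pow_mul]
    ring

/-- The product is a geometric sum in y = μ ω^z, where ω = `rootInv k`; multiplied by y - 1 it
becomes y^(2^k) - 1, of norm at most 2. -/
lemma norm_estimationAmplitude_mul_le (k : ℕ) {μ : ℂ} (hμ : ‖μ‖ = 1) (z : ℕ) :
    ‖estimationAmplitude k μ z‖ * ‖μ * (rootInv k : ℂ) ^ z - 1‖ ≤ 2 / 2 ^ k := by
  rw [← norm_mul, estimationAmplitude, Finset.prod_div_distrib, Finset.prod_const,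
    Finset.card_range, div_mul_eq_mul_div]
  have h : ∏ i ∈ Finset.range k, (1 + (μ * (rootInv k : ℂ) ^ z) ^ 2 ^ (k - 1 - i)) =
      ∏ i ∈ Finset.range k, (1 + (μ * (rootInv k : ℂ) ^ z) ^ 2 ^ i) :=
    Finset.prod_range_reflect (fun i => 1 + (μ * (rootInv k : ℂ) ^ z) ^ 2 ^ i) k
  rw [h, prod_one_add_pow_mul, norm_div, norm_pow, Complex.norm_two]
  gcongr
  refine (norm_sub_le _ _).trans ?_
  rw [norm_pow, norm_mul, hμ, norm_pow, Circle.norm_coe]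
  norm_num

/-- The right-hand side is the distance from μ to the unit number of angle 2πz/2^k, and the
left-hand side compares only real parts. -/
lemma abs_cos_sub_re_le (k : ℕ) (μ : ℂ) (z : ℕ) :
    |Real.cos (2 * Real.pi * z / 2 ^ k) - μ.re| ≤ ‖μ * (rootInv k : ℂ) ^ z - 1‖ := by
  have h1 : ((rootInv k ^ z)⁻¹ : Circle) = Circle.exp (2 * Real.pi * z / 2 ^ k) := by
    rw [rootInv, ← Circle.exp_natCast_mul, ← Circle.exp_neg]
    congr 1
    ring
  have h2 : ‖μ * (rootInv k : ℂ) ^ z - 1‖ = ‖μ - (((rootInv k ^ z)⁻¹ : Circle) : ℂ)‖ := by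
    have h3 : μ * (rootInv k : ℂ) ^ z - 1 =
        (μ - (((rootInv k ^ z)⁻¹ : Circle) : ℂ)) * ((rootInv k ^ z : Circle) : ℂ) := by
      rw [sub_mul, ← Circle.coe_mul, inv_mul_cancel, Circle.coe_pow, Circle.coe_one]
    rw [h3, norm_mul, Circle.norm_coe, mul_one]
  rw [h2, h1, abs_sub_comm]
  have h4 := Complex.abs_re_le_norm (μ - (Circle.exp (2 * Real.pi * z / 2 ^ k) : ℂ))
  rwa [Complex.sub_re, Circle.coe_exp, Complex.exp_ofReal_mul_I_re] at h4

/-- Jordan's inequality and sin v ≤ v on the first half of the interval, and the symmetry of the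
sine about π/2 on the second. The minimum is the cyclic distance to 0 modulo N. -/
lemma min_le_sin {N u : ℝ} (hN : 0 < N) (h0 : 0 ≤ u) (hu : u ≤ N) :
    2 * min u (N - u) / N ≤ Real.sin (Real.pi * u / N) ∧
      Real.sin (Real.pi * u / N) ≤ Real.pi * min u (N - u) / N := by
  have hπ := Real.pi_pos
  have key : ∀ v : ℝ, 0 ≤ v → 2 * v ≤ N → 2 * v / N ≤ Real.sin (Real.pi * v / N) ∧
      Real.sin (Real.pi * v / N) ≤ Real.pi * v / N := by
    intro v hv0 hv
    refine ⟨?_, Real.sin_le (by positivity)⟩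
    have := Real.mul_le_sin (x := Real.pi * v / N) (by positivity) (by
      rw [div_le_div_iff₀ hN two_pos]
      nlinarith)
    refine le_trans (le_of_eq ?_) this
    field_simp
  rcases le_total u (N - u) with h | h
  · rw [min_eq_left h]
    exact key u h0 (by linarith)
  · rw [min_eq_right h]
    have := key (N - u) (by linarith) (by linarith)
    rwa [show Real.pi * (N - u) / N = Real.pi - Real.pi * u / N by field_simp, Real.sin_pi_sub,
      show Real.pi - Real.pi * u / N = Real.pi * (N - u) / N by field_simp] at this

lemma exists_mul_rootInv_pow_eq (k : ℕ) {μ : ℂ} (hμ : ‖μ‖ = 1) :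
    ∃ t : ℝ, 0 ≤ t ∧ t ≤ 2 ^ k ∧ ∀ z : ℕ, z ≤ 2 ^ k →
      ‖μ * (rootInv k : ℂ) ^ z - 1‖ = 2 * Real.sin (Real.pi * |t - z| / 2 ^ k) := by
  have hπ := Real.pi_pos
  obtain ⟨θ, h0, h1, hθ⟩ : ∃ θ : ℝ, 0 ≤ θ ∧ θ ≤ 2 * Real.pi ∧ μ = Complex.exp (Complex.I * θ) := by
    have harg : μ = Complex.exp (Complex.I * μ.arg) := by
      have := Complex.norm_mul_exp_arg_mul_I μ
      rw [hμ, Complex.ofReal_one, one_mul, mul_comm] at this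
      exact this.symm
    have hlo := Complex.neg_pi_lt_arg μ
    have hhi := Complex.arg_le_pi μ
    rcases le_total 0 μ.arg with h | h
    · exact ⟨μ.arg, h, by linarith, harg⟩
    · refine ⟨μ.arg + 2 * Real.pi, by linarith, by linarith, ?_⟩
      push_cast
      rw [mul_add, show Complex.I * (2 * (Real.pi : ℂ)) = 2 * Real.pi * Complex.I by ring,
        Complex.exp_periodic]
      exact harg
  refine ⟨θ / (2 * Real.pi) * 2 ^ k, by positivity, ?_, fun z hz => ?_⟩
  · refine mul_le_of_le_one_left (by positivity) ?_
    rwa [div_le_one (by positivity)]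
  · have hz' : (z : ℝ) ≤ 2 ^ k := by exact_mod_cast hz
    have h2 : μ * (rootInv k : ℂ) ^ z =
        Complex.exp (Complex.I * ((2 * (Real.pi * (θ / (2 * Real.pi) * 2 ^ k - z) / 2 ^ k) : ℝ))) := by
      rw [hθ, ← Circle.coe_pow, rootInv, ← Circle.exp_natCast_mul, Circle.coe_exp, ← Complex.exp_add]
      congr 1
      push_cast
      have : (Real.pi : ℂ) ≠ 0 := by exact_mod_cast hπ.ne'
      field_simp
      ring
    rw [h2, Complex.norm_exp_I_mul_ofReal_sub_one, mul_div_cancel_left₀ _ two_ne_zero, norm_mul,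
      Real.norm_two, Real.norm_eq_abs]
    congr 1
    set u := θ / (2 * Real.pi) * 2 ^ k - z
    have hu : |u| ≤ 2 ^ k := by
      have : θ / (2 * Real.pi) * 2 ^ k ≤ 2 ^ k :=
        mul_le_of_le_one_left (by positivity) (by rwa [div_le_one (by positivity)])
      have : 0 ≤ θ / (2 * Real.pi) * 2 ^ k := by positivity
      rw [abs_le]
      constructor <;> linarith [Nat.cast_nonneg (α := ℝ) z]
    have hpos : 0 ≤ Real.sin (Real.pi * |u| / 2 ^ k) := by
      refine Real.sin_nonneg_of_nonneg_of_le_pi (by positivity) ?_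
      rw [div_le_iff₀ (by positivity)]
      exact mul_le_mul_of_nonneg_left hu hπ.le
    rcases abs_choice u with h | h
    · rw [h] at hpos ⊢
      exact abs_of_nonneg hpos
    · rw [h] at hpos ⊢
      rw [mul_neg, neg_div, Real.sin_neg] at hpos ⊢
      rw [← abs_neg]
      exact abs_of_nonneg hpos

/-- Let m be the cyclic distance modulo 2^k between z and the true phase t. An error of at least η
in the cosine forces m ≥ J = η 2^k/(2π), while the amplitude is at most 1/(2m). The weight is thus a
tail of a sum of 1/(4m²). -/
lemma sum_far_estimationAmplitude_le (k : ℕ) {μ : ℂ} (hμ : ‖μ‖ = 1) {η : ℝ} (hη : 0 < η)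
    (hk : 2 * Real.pi ≤ η * 2 ^ k) :
    ∑ z ∈ Finset.range (2 ^ k), (if η ≤ |Real.cos (2 * Real.pi * z / 2 ^ k) - μ.re| then
      ‖estimationAmplitude k μ z‖ ^ 2 else 0) ≤ 4 * Real.pi / (η * 2 ^ k) := by
  have hπ := Real.pi_pos
  obtain ⟨t, ht0, ht, hnorm⟩ := exists_mul_rootInv_pow_eq k hμ
  set N : ℝ := 2 ^ k with hN
  have hNpos : 0 < N := by positivity
  set J : ℝ := η * N / (2 * Real.pi) with hJdef
  have hJ : 1 ≤ J := (one_le_div (by positivity)).2 hk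
  set h : ℝ → ℝ := fun u => if J ≤ u then 1 / u ^ 2 else 0 with hh
  have hnn : ∀ u, 0 ≤ h u := fun u => by
    simp only [hh]
    split_ifs <;> positivity
  -- The four terms are the possible forms of the cyclic distance, according to the sign of t - z
  -- and to whether the interval wraps around. Adding all four avoids splitting the sum over z.
  have key : ∀ z ∈ Finset.range (2 ^ k),
      (if η ≤ |Real.cos (2 * Real.pi * z / N) - μ.re| then
        ‖estimationAmplitude k μ z‖ ^ 2 else 0) ≤
      1 / 4 * (h (z + -t) + h (t - z) + (h (z + (N - t)) + h (N + t - z))) := by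
    intro z hz
    have hzk : z ≤ 2 ^ k := (Finset.mem_range.1 hz).le
    have hzN : (z : ℝ) ≤ N := by
      rw [hN]
      exact_mod_cast hzk
    have hz0 : (0 : ℝ) ≤ z := Nat.cast_nonneg z
    split_ifs with hfar
    · have hu : |t - z| ≤ N := by
        rw [abs_le]
        constructor <;> linarith
      obtain ⟨hlo, hhi⟩ := min_le_sin hNpos (abs_nonneg (t - z)) hu
      have hdist := hfar.trans (abs_cos_sub_re_le k μ z)
      rw [hnorm z hzk] at hdist
      set m := min |t - z| (N - |t - z|) with hm
      have hmJ : J ≤ m := by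
        rw [hJdef, div_le_iff₀ (by positivity)]
        have h1 := hdist.trans (mul_le_mul_of_nonneg_left hhi zero_le_two)
        rw [← mul_div_assoc, le_div_iff₀ hNpos] at h1
        linarith
      have hm0 : 0 < m := by linarith
      have hamp : ‖estimationAmplitude k μ z‖ ≤ 1 / (2 * m) := by
        have h1 := norm_estimationAmplitude_mul_le k hμ z
        rw [hnorm z hzk] at h1
        have h2 : ‖estimationAmplitude k μ z‖ * (2 * (2 * m / N)) ≤ 2 / N :=
          le_trans (by gcongr) h1
        rw [le_div_iff₀ (by positivity)]
        have h3 : ‖estimationAmplitude k μ z‖ * (2 * (2 * m / N)) =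
          ‖estimationAmplitude k μ z‖ * (2 * m) * (2 / N) := by ring
        rw [h3] at h2
        exact le_of_mul_le_mul_right (by linarith) (show 0 < 2 / N by positivity)
      have hsq : ‖estimationAmplitude k μ z‖ ^ 2 ≤ 1 / 4 * h m := by
        have h1 : h m = 1 / m ^ 2 := if_pos hmJ
        rw [h1]
        refine (pow_le_pow_left₀ (norm_nonneg _) hamp 2).trans (le_of_eq ?_)
        field_simp
        norm_num
      refine hsq.trans (mul_le_mul_of_nonneg_left ?_ (by norm_num))
      have n1 := hnn (z + -t)
      have n2 := hnn (t - z)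
      have n3 := hnn (z + (N - t))
      have n4 := hnn (N + t - z)
      rcases abs_cases (t - z) with ⟨ha, -⟩ | ⟨ha, -⟩ <;>
        rcases min_choice |t - z| (N - |t - z|) with hc | hc
      · rw [hm, hc, ha]
        linarith
      · rw [hm, hc, ha, show N - (t - z) = z + (N - t) by ring]
        linarith
      · rw [hm, hc, ha, show -(t - z) = z + -t by ring]
        linarith
      · rw [hm, hc, ha, show N - -(t - z) = N + t - z by ring]
        linarith
    · have n1 := hnn (z + -t)
      have n2 := hnn (t - z)
      have n3 := hnn (z + (N - t))
      have n4 := hnn (N + t - z)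
      positivity
  refine (Finset.sum_le_sum key).trans ?_
  rw [← Finset.mul_sum, Finset.sum_add_distrib, Finset.sum_add_distrib, Finset.sum_add_distrib]
  have s1 := sum_inv_sq_le (2 ^ k) (-t) hJ
  have s2 := sum_inv_sq_le' (2 ^ k) t hJ
  have s3 := sum_inv_sq_le (2 ^ k) (N - t) hJ
  have s4 := sum_inv_sq_le' (2 ^ k) (N + t) hJ
  have hfin : 4 * Real.pi / (η * N) = 2 / J := by
    rw [hJdef]
    field_simp
    norm_num
  rw [hfin]
  simp only [hh]
  linarith

end Tail

/-! ### Rounding to randomly shifted grids -/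

section Rounding

/-- Round to the grid `a * (ℤ + s)`. -/
noncomputable def gridFloor (a s u : ℝ) : ℝ := a * (⌊u / a - s⌋ + s)

lemma abs_sub_gridFloor_le {a : ℝ} (ha : 0 < a) (s u : ℝ) : |u - gridFloor a s u| ≤ a := by
  have h1 := Int.floor_le (u / a - s)
  have h2 := Int.lt_floor_add_one (u / a - s)
  have h3 : u = a * (u / a) := by field_simp
  rw [gridFloor, abs_le]
  constructor
  · nlinarith
  · nlinarith

/-- The grids `a * (ℤ + r / R)` that have a point close to `c`, on which rounding is unstable. -/
def unstableShifts (R : ℕ) (a η c : ℝ) : Set (Fin R) :=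
  {r | ∃ u, |u - c| < η ∧ gridFloor a ((r : ℕ) / R) u ≠ gridFloor a ((r : ℕ) / R) c}

lemma exists_int_near_of_floor_ne {u v h : ℝ} (huv : |u - v| < h) (hne : ⌊u⌋ ≠ ⌊v⌋) :
    ∃ m : ℤ, |v - m| < h := by
  rw [abs_lt] at huv
  rcases lt_or_gt_of_ne hne with h1 | h1
  · refine ⟨⌊v⌋, ?_⟩
    have h2 := Int.floor_le v
    have h3 : u < ⌊v⌋ := Int.floor_lt.1 h1
    rw [abs_lt]
    constructor <;> linarith
  · refine ⟨⌊u⌋, ?_⟩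
    have h2 := Int.floor_le u
    have h3 : v < ⌊u⌋ := Int.floor_lt.1 h1
    rw [abs_lt]
    constructor <;> linarith

/-- If shift r is unstable, c/a - r/R is within η/a of an integer m, so Rc/a is within 1/2 of the
integer r + Rm. The inequality is strict, so this integer is unique, and r is its residue modulo R.
-/
lemma unstableShifts_subsingleton (R : ℕ) {a η : ℝ} (ha : 0 < a) (hη : 2 * R * η ≤ a) (c : ℝ) :
    (unstableShifts R a η c).Subsingleton := by
  have key : ∀ r ∈ unstableShifts R a η c, ∃ m : ℤ, |c / a - (r : ℕ) / R - m| < η / a := by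
    rintro r ⟨u, hu, hne⟩
    refine exists_int_near_of_floor_ne (u := u / a - (r : ℕ) / R) ?_ ?_
    · rw [sub_sub_sub_cancel_right, ← sub_div, abs_div, abs_of_pos ha]
      exact div_lt_div_of_pos_right hu ha
    · intro h
      exact hne (by rw [gridFloor, gridFloor, h])
  intro r hr r' hr'
  obtain ⟨m, hm⟩ := key r hr
  obtain ⟨m', hm'⟩ := key r' hr'
  have hR : (0 : ℝ) < R := by exact_mod_cast r.pos
  rw [abs_lt] at hm hm'
  have hηa : R * (η / a) ≤ 1 / 2 := by
    rw [← mul_div_assoc, div_le_div_iff₀ ha two_pos]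
    linarith
  have e1 : R * (c / a - (r : ℕ) / R - m) = R * (c / a) - r - R * m := by field_simp
  have e2 : R * (c / a - (r' : ℕ) / R - m') = R * (c / a) - r' - R * m' := by field_simp
  have l1 := mul_lt_mul_of_pos_left hm.1 hR
  have l2 := mul_lt_mul_of_pos_left hm.2 hR
  have l3 := mul_lt_mul_of_pos_left hm'.1 hR
  have l4 := mul_lt_mul_of_pos_left hm'.2 hR
  rw [e1] at l1 l2
  rw [e2] at l3 l4
  have i1 : ((r : ℕ) : ℝ) + R * m - (r' + R * m') < 1 := by linarith
  have i2 : ((r' : ℕ) : ℝ) + R * m' - (r + R * m) < 1 := by linarith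
  have j1 : ((r : ℕ) : ℤ) + R * m - ((r' : ℕ) + R * m') < 1 := by exact_mod_cast i1
  have j2 : ((r' : ℕ) : ℤ) + R * m' - ((r : ℕ) + R * m) < 1 := by exact_mod_cast i2
  have heq : ((r : ℕ) : ℤ) + R * m = (r' : ℕ) + R * m' := by omega
  have hmod : ((r : ℕ) : ℤ) % R = ((r' : ℕ) : ℤ) % R := by
    rw [← Int.add_mul_emod_self_left (r : ℕ) R m, heq, Int.add_mul_emod_self_left]
  rw [Int.emod_eq_of_lt (by omega) (by exact_mod_cast r.2),
    Int.emod_eq_of_lt (by omega) (by exact_mod_cast r'.2)] at hmod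
  exact Fin.ext (by exact_mod_cast hmod)

end Rounding

/-! ### The full register: two estimators, evaluation, uncomputation -/

section Register

lemma sum_bits_sum {A B M : Type} [Fintype A] [DecidableEq A] [Fintype B] [DecidableEq B]
    [AddCommMonoid M] (g : Bits (A ⊕ B) → M) :
    ∑ z, g z = ∑ u : Bits A, ∑ v : Bits B, g (Sum.elim u v) := by
  rw [← (Equiv.sumArrowEquivProdArrow A B Bool).symm.sum_comp, Fintype.sum_prod_type]
  rfl

lemma sum_bitsValue {k : ℕ} (h : ℕ → ℝ) :
    ∑ p : Bits (Fin k), h (bitsValue p) = ∑ z ∈ Finset.range (2 ^ k), h z := by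
  rw [← Fin.sum_univ_eq_sum_range]
  refine Fintype.sum_equiv
    ((Equiv.arrowCongr (Equiv.refl (Fin k)) finTwoEquiv.symm).trans finFunctionFinEquiv) _ _
    fun p => ?_
  congr 1
  rw [Equiv.trans_apply, finFunctionFinEquiv_apply, bitsValue]
  refine Finset.sum_congr rfl fun i _ => ?_
  cases h : p i <;> simp [h, finTwoEquiv]

variable {n b k : ℕ} (U V : QUnitary (Fin n)) (f : ℂ → Bits (Fin b))

/-- The estimate that belongs to the basis state `p` of the phase qubits. -/
noncomputable def estimate (p : Bits (Fin k)) : ℝ := Real.cos (2 * Real.pi * bitsValue p / 2 ^ k)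

lemma sum_norm_sq_bundle_mul (F : Bits (Fin k) → QState (Option (Fin n)))
    (χ : Bits (Fin k) → ℝ) :
    ∑ z : Bits (EstimatorWire n k), ‖bundle F z‖ ^ 2 * χ (fun j => z (Sum.inr j)) =
      ∑ p, ‖F p‖ ^ 2 * χ p := by
  rw [sum_bits_sum, Finset.sum_comm]
  refine Finset.sum_congr rfl fun p _ => ?_
  rw [sum_bits_sum, EuclideanSpace.norm_sq_eq, Finset.sum_mul]
  simp only [bundle_apply, Sum.elim_inl, Sum.elim_inr]
  refine Finset.sum_congr rfl fun a _ => ?_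
  rw [Finset.sum_eq_single fun _ => false]
  · simp
  · intro c _ hc
    have hc' : ¬ ∀ i, c i = false := fun h => hc (funext h)
    simp [hc']
  · simp

/-- The single-eigenvalue tail bound applies to both conjugate eigenvalues with the same target c.
The components have norm at most 1, and (s + t)² ≤ 2s² + 2t² turns 4π into 16π. -/
lemma sum_far_estimator_le {x y : QState (Fin n)} (hx : Prepares U x) (hy : Prepares V y)
    (lam : Circle) {η : ℝ} (hη : 0 < η) (hk : 2 * Real.pi ≤ η * 2 ^ k) {c : ℝ}
    (hc : c = -(lam * inner ℂ x y : ℂ).re) :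
    ∑ z : Bits (EstimatorWire n k),
      ‖(estimator lam : Circuit _ n b).run U V f (zeroState _) z‖ ^ 2 *
        (if η ≤ |estimate (fun j => z (Sum.inr j)) - c| then 1 else 0) ≤
        16 * Real.pi / (η * 2 ^ k) := by
  obtain ⟨μ, v, v', hμ, hre, hv, hv', hsum, hn, hn'⟩ := exists_groverMap_eigenvectors U V f hx hy lam
  have hμ' : ‖starRingEnd ℂ μ‖ = 1 := by rw [RCLike.norm_conj, hμ]
  rw [estimator_run U V f hx hy hv hv' hsum,
    sum_norm_sq_bundle_mul (χ := fun p => if η ≤ |estimate p - c| then 1 else 0)]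
  have t1 := sum_far_estimationAmplitude_le k hμ hη hk
  have t2 := sum_far_estimationAmplitude_le k hμ' hη hk
  rw [Complex.conj_re, hre, ← hc] at t2
  rw [hre, ← hc] at t1
  rw [← sum_bitsValue (fun z => if η ≤ |Real.cos (2 * Real.pi * z / 2 ^ k) - c| then
    ‖estimationAmplitude k μ z‖ ^ 2 else 0)] at t1
  rw [← sum_bitsValue (fun z => if η ≤ |Real.cos (2 * Real.pi * z / 2 ^ k) - c| then
    ‖estimationAmplitude k (starRingEnd ℂ μ) z‖ ^ 2 else 0)] at t2
  have hle : ∀ p : Bits (Fin k), ‖estimationAmplitude k μ (bitsValue p) • v +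
        estimationAmplitude k (starRingEnd ℂ μ) (bitsValue p) • v'‖ ^ 2 *
      (if η ≤ |estimate p - c| then 1 else 0) ≤
      2 * (if η ≤ |Real.cos (2 * Real.pi * bitsValue p / 2 ^ k) - c| then
        ‖estimationAmplitude k μ (bitsValue p)‖ ^ 2 else 0) +
      2 * (if η ≤ |Real.cos (2 * Real.pi * bitsValue p / 2 ^ k) - c| then
        ‖estimationAmplitude k (starRingEnd ℂ μ) (bitsValue p)‖ ^ 2 else 0) := by
    intro p
    rw [estimate]
    split_ifs
    · have h1 := norm_add_le (estimationAmplitude k μ (bitsValue p) • v)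
        (estimationAmplitude k (starRingEnd ℂ μ) (bitsValue p) • v')
      rw [norm_smul, norm_smul] at h1
      have h2 := mul_le_of_le_one_right (norm_nonneg (estimationAmplitude k μ (bitsValue p))) hn
      have h3 := mul_le_of_le_one_right
        (norm_nonneg (estimationAmplitude k (starRingEnd ℂ μ) (bitsValue p))) hn'
      have h4 := pow_le_pow_left₀ (norm_nonneg _) (h1.trans (add_le_add h2 h3)) 2
      nlinarith [sq_nonneg (‖estimationAmplitude k μ (bitsValue p)‖ -
        ‖estimationAmplitude k (starRingEnd ℂ μ) (bitsValue p)‖)]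
    · simp
  refine (Finset.sum_le_sum fun p _ => hle p).trans ?_
  rw [Finset.sum_add_distrib, ← Finset.mul_sum, ← Finset.mul_sum]
  have e : 16 * Real.pi / (η * 2 ^ k) = 4 * (4 * Real.pi / (η * 2 ^ k)) := by ring
  rw [e]
  linarith

lemma norm_sq_run_zeroState {κ : Type} [Fintype κ] [DecidableEq κ] (c : Circuit κ n b) :
    ∑ z, ‖c.run U V f (zeroState κ) z‖ ^ 2 = 1 := by
  rw [← EuclideanSpace.norm_sq_eq, Circuit.norm_run, norm_zeroState, one_pow]

/-- The number of work qubits: two estimators. -/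
abbrev workSize (n k : ℕ) : ℕ := Fintype.card (EstimatorWire n k ⊕ EstimatorWire n k)

/-- The position of the two estimators among the work qubits. -/
noncomputable def workEquiv (n k : ℕ) :
    EstimatorWire n k ⊕ EstimatorWire n k ≃ Fin (workSize n k) := Fintype.equivFin _

/-- The position of the first estimator. -/
noncomputable def firstEmbedding (n b k : ℕ) : EstimatorWire n k ↪ Wire n b (workSize n k) :=
  ⟨fun i => Sum.inr (Sum.inr (Sum.inr (workEquiv n k (Sum.inl i)))), fun i j h => by
    simpa using h⟩

/-- The position of the second estimator. -/
noncomputable def secondEmbedding (n b k : ℕ) : EstimatorWire n k ↪ Wire n b (workSize n k) :=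
  ⟨fun i => Sum.inr (Sum.inr (Sum.inr (workEquiv n k (Sum.inr i)))), fun i j h => by
    simpa using h⟩

lemma firstEmbedding_apply (i : EstimatorWire n k) : firstEmbedding n b k i =
    Sum.inr (Sum.inr (Sum.inr (workEquiv n k (Sum.inl i)))) := rfl

lemma secondEmbedding_apply (i : EstimatorWire n k) : secondEmbedding n b k i =
    Sum.inr (Sum.inr (Sum.inr (workEquiv n k (Sum.inr i)))) := rfl

/-- The position of the two phase registers and of the output qubits. -/
noncomputable def evaluationEmbedding (n b k : ℕ) :
    (Fin k ⊕ (Fin k ⊕ Fin b)) ↪ Wire n b (workSize n k) :=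
  ⟨Sum.elim (fun i => firstEmbedding n b k (Sum.inr i))
    (Sum.elim (fun i => secondEmbedding n b k (Sum.inr i)) fun j => Sum.inr (Sum.inr (Sum.inl j))),
    by
      rintro (i | i | i) (j | j | j) h <;>
        simp_all [firstEmbedding_apply, secondEmbedding_apply]⟩

/-- The amplitude of the input state. -/
noncomputable def inputAmplitude (x y : QState (Fin n)) (c : Bool) (a : Bits (Fin n)) : ℂ :=
  ((1 / √2 : ℝ) : ℂ) * (if c then y a else x a)

/-- The input state, with the output qubits in the state `v`, and with estimators in the states
`φ` and `φ'`. -/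
noncomputable def jointState (x y : QState (Fin n)) (v : Bits (Fin b))
    (φ φ' : QState (EstimatorWire n k)) : QState (Wire n b (workSize n k)) :=
  WithLp.toLp 2 fun z => φ (fun i => z (firstEmbedding n b k i)) *
    (φ' (fun i => z (secondEmbedding n b k i)) *
      (inputAmplitude x y (z (Sum.inl ())) (fun i => z (Sum.inr (Sum.inl i))) *
        if (fun j => z (Sum.inr (Sum.inr (Sum.inl j)))) = v then 1 else 0))

lemma jointState_apply (x y : QState (Fin n)) (v : Bits (Fin b))
    (φ φ' : QState (EstimatorWire n k)) (z : Bits (Wire n b (workSize n k))) :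
    jointState x y v φ φ' z = φ (fun i => z (firstEmbedding n b k i)) *
    (φ' (fun i => z (secondEmbedding n b k i)) *
      (inputAmplitude x y (z (Sum.inl ())) (fun i => z (Sum.inr (Sum.inl i))) *
        if (fun j => z (Sum.inr (Sum.inr (Sum.inl j)))) = v then 1 else 0)) := rfl

lemma pairState_eq (x y : QState (Fin n)) (v : Bits (Fin b)) :
    pairState (workSize n k) x y v = jointState x y v (zeroState _) (zeroState _) := by
  ext z
  have h : (∀ j, z (Sum.inr (Sum.inr (Sum.inr j))) = false) ↔
      (∀ i, z (firstEmbedding n b k i) = false) ∧ ∀ i, z (secondEmbedding n b k i) = false := by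
    rw [← (workEquiv n k).forall_congr_right, Sum.forall]
    rfl
  simp only [pairState, jointState_apply, zeroState, h, inputAmplitude, funext_iff]
  have key : ∀ (P P' P'' : Prop) [Decidable P] [Decidable P'] [Decidable P'']
      [Decidable (P'' ∧ P ∧ P')] (c : ℂ), (if P'' ∧ P ∧ P' then c else 0) =
        (if P then 1 else 0) * ((if P' then 1 else 0) * (c * if P'' then 1 else 0)) := by
    intro P P' P'' _ _ _ _ c
    by_cases h1 : P <;> by_cases h2 : P' <;> by_cases h3 : P'' <;> simp [h1, h2, h3]
  exact key _ _ _ _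

/-- The two estimations. -/
noncomputable def estimators (n b k : ℕ) : Circuit (Wire n b (workSize n k)) n b :=
  Circuit.relabel (firstEmbedding n b k) (estimator (Circle.exp Real.pi)) ++
    Circuit.relabel (secondEmbedding n b k) (estimator (Circle.exp (Real.pi / 2)))

lemma estimators_run (x y : QState (Fin n)) (v : Bits (Fin b)) :
    (estimators n b k).run U V f (jointState x y v (zeroState _) (zeroState _)) =
      jointState x y v
        ((estimator (Circle.exp Real.pi) : Circuit _ n b).run U V f (zeroState _))
        ((estimator (Circle.exp (Real.pi / 2)) : Circuit _ n b).run U V f (zeroState _)) := by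
  have h1 : ∀ (a : Bits (EstimatorWire n k)) (z : Bits (Wire n b (workSize n k))) i,
      (∀ j, firstEmbedding n b k j ≠ i) → extend (firstEmbedding n b k) a z i = z i :=
    fun a z i hi => extend_apply' _ _ _ (by simpa using hi)
  have h2 : ∀ (a : Bits (EstimatorWire n k)) (z : Bits (Wire n b (workSize n k))) i,
      (∀ j, secondEmbedding n b k j ≠ i) → extend (secondEmbedding n b k) a z i = z i :=
    fun a z i hi => extend_apply' _ _ _ (by simpa using hi)
  rw [estimators, Circuit.run_append, jointState, Circuit.run_relabel_mul]
  · have hcomm : ∀ φ φ' : QState (EstimatorWire n k), jointState x y v φ φ' =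
        WithLp.toLp 2 fun z => φ' (fun i => z (secondEmbedding n b k i)) *
          (φ (fun i => z (firstEmbedding n b k i)) *
          (inputAmplitude x y (z (Sum.inl ())) (fun i => z (Sum.inr (Sum.inl i))) *
          if (fun j => z (Sum.inr (Sum.inr (Sum.inl j)))) = v then 1 else 0)) := by
      intro φ φ'
      ext z
      exact mul_left_comm _ _ _
    refine (congrArg _ (hcomm _ _)).trans ?_
    rw [Circuit.run_relabel_mul, hcomm]
    intro a z
    simp only [fun i => h2 a z _ (fun j => show secondEmbedding n b k j ≠ firstEmbedding n b k i by
      simp [firstEmbedding_apply, secondEmbedding_apply]), h2 a z (Sum.inl ()) (by simp [secondEmbedding_apply]),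
      fun i => h2 a z (Sum.inr (Sum.inl i)) (by simp [secondEmbedding_apply]),
      fun i => h2 a z (Sum.inr (Sum.inr (Sum.inl i))) (by simp [secondEmbedding_apply])]
  · intro a z
    simp only [fun i => h1 a z _ (fun j => show firstEmbedding n b k j ≠ secondEmbedding n b k i by
      simp [firstEmbedding_apply, secondEmbedding_apply]), h1 a z (Sum.inl ()) (by simp [firstEmbedding_apply]),
      fun i => h1 a z (Sum.inr (Sum.inl i)) (by simp [firstEmbedding_apply]),
      fun i => h1 a z (Sum.inr (Sum.inr (Sum.inl i))) (by simp [firstEmbedding_apply])]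

/-- Stated amplitude by amplitude, because the value written to the output depends on the phase
qubits of `z`; the resulting state need not be a product. -/
lemma evaluate_run_jointState (re im : Bits (Fin k) → ℝ) (x y : QState (Fin n))
    (φ φ' : QState (EstimatorWire n k)) (z : Bits (Wire n b (workSize n k))) :
    (Gate.evaluate k k re im (evaluationEmbedding n b k)).run U V f
      (jointState x y (fun _ => false) φ φ') z =
      jointState x y (f ⟨re fun i => z (firstEmbedding n b k (Sum.inr i)),
        im fun i => z (secondEmbedding n b k (Sum.inr i))⟩) φ φ' z := by
  set w : Bits (Fin b) := f ⟨re fun i => z (firstEmbedding n b k (Sum.inr i)),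
        im fun i => z (secondEmbedding n b k (Sum.inr i))⟩ with hw
  set z' : Bits (Wire n b (workSize n k)) := Sum.elim (fun i => z (Sum.inl i))
    (Sum.elim (fun i => z (Sum.inr (Sum.inl i))) (Sum.elim
      (fun j => xor (z (Sum.inr (Sum.inr (Sum.inl j)))) (w j))
      fun i => z (Sum.inr (Sum.inr (Sum.inr i))))) with hz'
  have hext : extend (evaluationEmbedding n b k) (evaluationPerm f re im fun j =>
      z (evaluationEmbedding n b k j)) z = z' := by
    refine extend_eq_of _ _ _ _ ?_ ?_
    · rintro (i | i | i) <;> rfl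
    · rintro (i | i | i | i) hi
      · rfl
      · rfl
      · exact absurd rfl (hi (Sum.inr (Sum.inr i)))
      · rfl
  have hrun : (Gate.evaluate k k re im (evaluationEmbedding n b k)).run U V f
      (jointState x y (fun _ => false) φ φ') z = jointState x y (fun _ => false) φ φ' z' := by
    rw [← hext]
    change applyOn _ (evaluation f re im) _ z = _
    rw [evaluation_eq, applyOn_monomialUnitary]
    simp
  have hiff : ((fun j => z' (Sum.inr (Sum.inr (Sum.inl j)))) = fun _ => false) ↔
      (fun j => z (Sum.inr (Sum.inr (Sum.inl j)))) = w := by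
    simp [hz', funext_iff]
  rw [hrun, jointState_apply, jointState_apply, if_congr hiff rfl rfl]
  rfl

lemma sum_inputAmplitude {x y : QState (Fin n)} (hx : Prepares U x) (hy : Prepares V y) :
    ∑ u : Bits Unit, ∑ a, ‖inputAmplitude x y (u ()) a‖ ^ 2 = 1 := by
  have h := norm_pairVector U V hx hy
  rw [← pow_eq_one_iff_of_nonneg (norm_nonneg _) two_ne_zero, EuclideanSpace.norm_sq_eq,
    ← bitsOptionEquiv.symm.sum_comp, Fintype.sum_prod_type] at h
  rw [← (Equiv.funUnique Unit Bool).symm.sum_comp]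
  exact h

lemma sum_wire (g : Bits (Wire n b (workSize n k)) → ℝ) :
    ∑ z, g z = ∑ u : Bits Unit, ∑ a : Bits (Fin n), ∑ o : Bits (Fin b),
      ∑ p : Bits (EstimatorWire n k), ∑ q : Bits (EstimatorWire n k),
        g (Sum.elim u (Sum.elim a (Sum.elim o fun i => Sum.elim p q ((workEquiv n k).symm i)))) := by
  rw [sum_bits_sum]
  refine Finset.sum_congr rfl fun u _ => ?_
  rw [sum_bits_sum]
  refine Finset.sum_congr rfl fun a _ => ?_
  rw [sum_bits_sum]
  refine Finset.sum_congr rfl fun o _ => ?_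
  rw [← (Equiv.arrowCongr (workEquiv n k) (Equiv.refl Bool)).sum_comp, sum_bits_sum]
  rfl

/-- The whole circuit: estimate the real and the imaginary part of the inner product, evaluate the
function at the rounded estimates, and undo the estimations. -/
noncomputable def innerProductCircuit (n b k : ℕ) (a s : ℝ) :
    Circuit (Wire n b (workSize n k)) n b :=
  estimators n b k ++ (Gate.evaluate k k (fun p => gridFloor a s (estimate p))
    (fun p => gridFloor a s (estimate p)) (evaluationEmbedding n b k) ::
      (estimators n b k).inv)

lemma innerProductCircuit_time_le (a s : ℝ) (T : ℕ) (hT : 1 ≤ T) (hnT : n ≤ T) :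
    (innerProductCircuit n b k a s).time T ≤ 99 * (T * 2 ^ k) := by
  rw [innerProductCircuit, Circuit.time_append, Circuit.time_cons, Circuit.time_inv, estimators,
    Circuit.time_append, Circuit.time_relabel, Circuit.time_relabel]
  -- Two estimators, run forwards and backwards, give 4 · 24 = 96; the evaluation, of time 2 · 2^k +
  -- 1, accounts for the other 3.
  have h1 := estimator_time_le (b := b) (k := k) (Circle.exp Real.pi) T hT hnT
  have h2 := estimator_time_le (b := b) (k := k) (Circle.exp (Real.pi / 2)) T hT hnT
  have h3 : 2 ^ k ≤ T * 2 ^ k := Nat.le_mul_of_pos_left _ hT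
  have h4 : 1 ≤ 2 ^ k := Nat.one_le_two_pow
  simp only [Gate.time]
  omega

/-- By `hre` and `him`, the evaluation writes the intended value whenever both estimates are within
η of the truth, so the error comes only from the weight of bad outcomes. -/
lemma norm_innerProductCircuit_sub_le {x y : QState (Fin n)} (hx : Prepares U x)
    (hy : Prepares V y) {η a s : ℝ} (hη : 0 < η) (hk : 2 * Real.pi ≤ η * 2 ^ k)
    (hre : ∀ u, |u - (inner ℂ x y : ℂ).re| < η → gridFloor a s u =
      gridFloor a s (inner ℂ x y : ℂ).re)
    (him : ∀ u, |u - (inner ℂ x y : ℂ).im| < η → gridFloor a s u =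
      gridFloor a s (inner ℂ x y : ℂ).im) :
    ‖(innerProductCircuit n b k a s).run U V f (pairState _ x y fun _ => false) -
      pairState _ x y (f ⟨gridFloor a s (inner ℂ x y : ℂ).re,
        gridFloor a s (inner ℂ x y : ℂ).im⟩)‖ ^ 2 ≤ 64 * Real.pi / (η * 2 ^ k) := by
  set w := f ⟨gridFloor a s (inner ℂ x y : ℂ).re, gridFloor a s (inner ℂ x y : ℂ).im⟩ with hw
  set Φ : QState (EstimatorWire n k) :=
    (estimator (Circle.exp Real.pi) : Circuit _ n b).run U V f (zeroState _) with hΦ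
  set Φ' : QState (EstimatorWire n k) :=
    (estimator (Circle.exp (Real.pi / 2)) : Circuit _ n b).run U V f (zeroState _) with hΦ'
  have hsum : ∑ z, ‖Φ z‖ ^ 2 = 1 := norm_sq_run_zeroState U V f _
  have hsum' : ∑ z, ‖Φ' z‖ ^ 2 = 1 := norm_sq_run_zeroState U V f _
  set far : Bits (EstimatorWire n k) → ℝ := fun z =>
    if η ≤ |estimate (fun j => z (Sum.inr j)) - (inner ℂ x y : ℂ).re| then 1 else 0 with hfar
  set far' : Bits (EstimatorWire n k) → ℝ := fun z =>
    if η ≤ |estimate (fun j => z (Sum.inr j)) - (inner ℂ x y : ℂ).im| then 1 else 0 with hfar'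
  have hbad : ∑ z, ‖Φ z‖ ^ 2 * far z ≤ 16 * Real.pi / (η * 2 ^ k) := by
    -- λ = -1 selects the real part; below, λ = i selects the imaginary part, since -Re(iz) = Im z.
    have := sum_far_estimator_le (b := b) U V f hx hy (Circle.exp Real.pi) hη hk
      (c := (inner ℂ x y : ℂ).re) (by rw [Circle.coe_exp, Complex.exp_pi_mul_I]; simp)
    exact this
  have hbad' : ∑ z, ‖Φ' z‖ ^ 2 * far' z ≤ 16 * Real.pi / (η * 2 ^ k) := by
    have := sum_far_estimator_le (b := b) U V f hx hy (Circle.exp (Real.pi / 2)) hη hk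
      (c := (inner ℂ x y : ℂ).im) (by
        rw [Circle.coe_exp]
        push_cast
        rw [Complex.exp_pi_div_two_mul_I]
        simp)
    exact this
  -- The target is written as the result of undoing the estimations on the ideal state. As the
  -- uncomputation is an isometry, the comparison can be made just before it.
  rw [pairState_eq, pairState_eq, innerProductCircuit, Circuit.run_append, Circuit.run_cons,
    estimators_run, ← hΦ, ← hΦ',
    ← Circuit.run_inv_run U V f (estimators n b k) (jointState x y w (zeroState _) (zeroState _)),
    ← Circuit.run_sub, Circuit.norm_run, estimators_run, ← hΦ, ← hΦ', EuclideanSpace.norm_sq_eq,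
    sum_wire]
  have hterm : ∀ (u : Bits Unit) (c : Bits (Fin n)) (o : Bits (Fin b))
      (p q : Bits (EstimatorWire n k)),
      ‖((Gate.evaluate k k (fun p => gridFloor a s (estimate p))
        (fun p => gridFloor a s (estimate p)) (evaluationEmbedding n b k)).run U V f
          (jointState x y (fun _ => false) Φ Φ') - jointState x y w Φ Φ')
        (Sum.elim u (Sum.elim c (Sum.elim o fun i => Sum.elim p q ((workEquiv n k).symm i))))‖ ^ 2 ≤
      ‖inputAmplitude x y (u ()) c‖ ^ 2 * ((‖Φ p‖ ^ 2 * ‖Φ' q‖ ^ 2 * (far p + far' q)) *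
        ((if o = f ⟨gridFloor a s (estimate fun j => p (Sum.inr j)),
            gridFloor a s (estimate fun j => q (Sum.inr j))⟩ then 1 else 0) +
          if o = w then 1 else 0)) := by
    intro u c o p q
    rw [PiLp.sub_apply, evaluate_run_jointState]
    simp only [jointState_apply, firstEmbedding_apply, secondEmbedding_apply, Sum.elim_inl,
      Sum.elim_inr, Equiv.symm_apply_apply]
    rw [← mul_sub, ← mul_sub, ← mul_sub, norm_mul, norm_mul, norm_mul, mul_pow, mul_pow, mul_pow]
    have hnn : 0 ≤ far p := by simp only [hfar]; split_ifs <;> norm_num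
    have hnn' : 0 ≤ far' q := by simp only [hfar']; split_ifs <;> norm_num
    set w' := f ⟨gridFloor a s (estimate fun j => p (Sum.inr j)),
            gridFloor a s (estimate fun j => q (Sum.inr j))⟩ with hw'
    -- If the values differ, at least one estimate is far, so the first factor on the right is at
    -- least 1; otherwise the left side vanishes.
    have hmain : ‖((if o = w' then (1 : ℂ) else 0) - if o = w then 1 else 0)‖ ^ 2 ≤
        (far p + far' q) * ((if o = w' then 1 else 0) + if o = w then 1 else 0) := by
      by_cases hpq : w' = w
      · rw [hpq, sub_self, norm_zero]
        have : (0 : ℝ) ≤ if o = w then 1 else 0 := by split_ifs <;> norm_num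
        nlinarith
      · have h1 : 1 ≤ far p + far' q := by
          by_contra hlt
          apply hpq
          have hp : ¬ η ≤ |estimate (fun j => p (Sum.inr j)) - (inner ℂ x y : ℂ).re| := by
            intro h
            simp only [hfar, if_pos h] at hlt
            linarith
          have hq : ¬ η ≤ |estimate (fun j => q (Sum.inr j)) - (inner ℂ x y : ℂ).im| := by
            intro h
            simp only [hfar', if_pos h] at hlt
            linarith
          rw [hw', hw, hre _ (not_le.1 hp), him _ (not_le.1 hq)]
        split_ifs with h2 h3 <;> norm_num <;> linarith
    calc _ ≤ ‖Φ p‖ ^ 2 * (‖Φ' q‖ ^ 2 * (‖inputAmplitude x y (u ()) c‖ ^ 2 *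
          ((far p + far' q) * ((if o = w' then 1 else 0) + if o = w then 1 else 0)))) := by
          gcongr
          exact hmain
      _ = _ := by ring
  refine (Finset.sum_le_sum fun u _ => Finset.sum_le_sum fun c _ => Finset.sum_le_sum fun o _ =>
    Finset.sum_le_sum fun p _ => Finset.sum_le_sum fun q _ => hterm u c o p q).trans ?_
  simp only [← Finset.mul_sum]
  -- For fixed p and q each of the two indicators is 1 for exactly one output string, whence the
  -- factor 2.
  have hinner : ∑ o : Bits (Fin b), ∑ p : Bits (EstimatorWire n k), ∑ q : Bits (EstimatorWire n k),
      (‖Φ p‖ ^ 2 * ‖Φ' q‖ ^ 2 * (far p + far' q)) *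
        ((if o = f ⟨gridFloor a s (estimate fun j => p (Sum.inr j)),
            gridFloor a s (estimate fun j => q (Sum.inr j))⟩ then 1 else 0) +
          if o = w then 1 else 0) =
      2 * ∑ p : Bits (EstimatorWire n k), ∑ q : Bits (EstimatorWire n k),
        (‖Φ p‖ ^ 2 * ‖Φ' q‖ ^ 2 * (far p + far' q)) := by
    rw [Finset.sum_comm, Finset.mul_sum]
    refine Finset.sum_congr rfl fun p _ => ?_
    rw [Finset.sum_comm, Finset.mul_sum]
    refine Finset.sum_congr rfl fun q _ => ?_
    rw [← Finset.mul_sum, Finset.sum_add_distrib]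
    simp only [Finset.sum_ite_eq', Finset.mem_univ, if_true]
    ring
  rw [hinner]
  simp only [← Finset.sum_mul]
  rw [sum_inputAmplitude U V hx hy, one_mul]
  have hsplit : ∑ p : Bits (EstimatorWire n k), ∑ q : Bits (EstimatorWire n k),
      (‖Φ p‖ ^ 2 * ‖Φ' q‖ ^ 2 * (far p + far' q)) =
      (∑ p, ‖Φ p‖ ^ 2 * far p) * (∑ q, ‖Φ' q‖ ^ 2) +
        (∑ p, ‖Φ p‖ ^ 2) * ∑ q, ‖Φ' q‖ ^ 2 * far' q := by
    rw [Finset.sum_mul_sum, Finset.sum_mul_sum, ← Finset.sum_add_distrib]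
    refine Finset.sum_congr rfl fun p _ => ?_
    rw [← Finset.sum_add_distrib]
    refine Finset.sum_congr rfl fun q _ => ?_
    ring
  rw [hsplit, hsum, hsum', mul_one, one_mul]
  have e : 64 * Real.pi / (η * 2 ^ k) = 4 * (16 * Real.pi / (η * 2 ^ k)) := by ring
  rw [e]
  linarith

end Register

/-! ### Choice of the parameters -/

theorem mainTheorem2 (δ : ℝ) (hδ : 0 < δ) :
    ∃ (C : ℝ) (R : ℕ), 0 < C ∧ 0 < R ∧
      ∀ (n b : ℕ) (ε : ℝ), 0 < ε → ε ≤ 1 →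
        ∃ (w : ℕ) (c : Fin R → Circuit (Wire n b w) n b),
          (∀ (r : Fin R) (T : ℕ), 1 ≤ T → n ≤ T → ((c r).time T : ℝ) ≤ C * T / ε) ∧
          ∀ (f : ℂ → Bits (Fin b)) (x y : QState (Fin n)) (U V : QUnitary (Fin n)),
            Prepares U x → Prepares V y →
            (1 - δ) * (R : ℝ) ≤
              (Set.ncard {r : Fin R | ∃ s : ℂ, ‖inner ℂ x y - s‖ ≤ ε ∧
                ‖(c r).run U V f (pairState w x y (fun _ => false)) -
                  pairState w x y (f s)‖ ≤ δ} : ℝ) := by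
  have hπ := Real.pi_pos
  obtain ⟨R, hR⟩ := exists_nat_ge (2 / δ)
  have hR0 : (0 : ℝ) < R := lt_of_lt_of_le (by positivity) hR
  have hRpos : 0 < R := by exact_mod_cast hR0
  have hR1 : (1 : ℝ) ≤ R := by exact_mod_cast hRpos
  have hRδ : 2 ≤ δ * R := by
    rw [div_le_iff₀ hδ] at hR
    linarith
  -- With η = ε/(4R) and 2^k ≥ K/ε, this gives η 2^k ≥ 64π/δ² + 2π: the first summand makes the
  -- squared error at most δ², the second is the hypothesis of the tail bound.
  set K : ℝ := 4 * R * (64 * Real.pi / δ ^ 2 + 2 * Real.pi) with hK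
  have hK1 : 1 ≤ K := by
    have h1 : 1 ≤ 2 * Real.pi := by linarith [Real.pi_gt_three]
    have h2 : 0 < 64 * Real.pi / δ ^ 2 := by positivity
    nlinarith
  refine ⟨198 * K, R, by positivity, hRpos, fun n b ε hε hε1 => ?_⟩
  -- 2^(m + 1) is the first power of 2 above K/ε, hence at most 2K/ε; the constant 198 is 2 · 99.
  obtain ⟨m, hm, hm'⟩ := exists_nat_pow_near (x := K / ε) (y := 2)
    ((one_le_div hε).2 (hε1.trans hK1)) one_lt_two
  set k := m + 1 with hk
  have hk2 : (2 : ℝ) ^ k ≤ 2 * (K / ε) := by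
    rw [hk, pow_succ]
    linarith
  set η : ℝ := ε / (4 * R) with hη
  have hη0 : 0 < η := by positivity
  have hηk : 64 * Real.pi / δ ^ 2 + 2 * Real.pi ≤ η * 2 ^ k := by
    refine le_trans (le_of_eq ?_) (mul_le_mul_of_nonneg_left hm'.le hη0.le)
    rw [hη, hK]
    field_simp
  refine ⟨workSize n k, fun r => innerProductCircuit n b k (ε / 2) ((r : ℕ) / R), ?_, ?_⟩
  · intro r T hT hnT
    have h1 : ((innerProductCircuit n b k (ε / 2) ((r : ℕ) / R)).time T : ℝ) ≤
        99 * (T * 2 ^ k) := by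
      exact_mod_cast innerProductCircuit_time_le (b := b) (k := k) (ε / 2) ((r : ℕ) / R) T hT hnT
    refine h1.trans ?_
    calc 99 * ((T : ℝ) * 2 ^ k) ≤ 99 * (T * (2 * (K / ε))) := by gcongr
      _ = 198 * K * T / ε := by ring
  · intro f x y U V hx hy
    set B := unstableShifts R (ε / 2) η (inner ℂ x y : ℂ).re ∪
      unstableShifts R (ε / 2) η (inner ℂ x y : ℂ).im with hB
    have ha : 0 < ε / 2 := by positivity
    -- The grid width ε/2 allows an error of ε/2 in each coordinate, ε in total, and η is the
    -- largest value for which the shifts are separated.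
    have hηa : 2 * R * η ≤ ε / 2 := by
      rw [hη]
      refine le_of_eq ?_
      field_simp
      norm_num
    have hBcard : B.ncard ≤ 2 := by
      refine (Set.ncard_union_le _ _).trans (Nat.add_le_add (b := 1) (d := 1) ?_ ?_) <;>
      exact Set.ncard_le_one_iff_subsingleton.2 (unstableShifts_subsingleton R ha hηa _)
    have hsub : Bᶜ ⊆ {r : Fin R | ∃ s : ℂ, ‖inner ℂ x y - s‖ ≤ ε ∧
        ‖(innerProductCircuit n b k (ε / 2) ((r : ℕ) / R)).run U V f
          (pairState _ x y (fun _ => false)) - pairState _ x y (f s)‖ ≤ δ} := by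
      intro r hr
      rw [hB, Set.compl_union] at hr
      have stable : ∀ c, r ∉ unstableShifts R (ε / 2) η c → ∀ u, |u - c| < η →
          gridFloor (ε / 2) ((r : ℕ) / R) u = gridFloor (ε / 2) ((r : ℕ) / R) c :=
        fun c hc u hu => by_contra fun hne => hc ⟨u, hu, hne⟩
      refine ⟨⟨gridFloor (ε / 2) ((r : ℕ) / R) (inner ℂ x y : ℂ).re,
        gridFloor (ε / 2) ((r : ℕ) / R) (inner ℂ x y : ℂ).im⟩, ?_, ?_⟩
      · refine (Complex.norm_le_abs_re_add_abs_im _).trans ?_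
        have h1 := abs_sub_gridFloor_le ha ((r : ℕ) / R) (inner ℂ x y : ℂ).re
        have h2 := abs_sub_gridFloor_le ha ((r : ℕ) / R) (inner ℂ x y : ℂ).im
        simp only [Complex.sub_re, Complex.sub_im]
        linarith
      · refine le_of_sq_le_sq ?_ hδ.le
        refine (norm_innerProductCircuit_sub_le U V f hx hy hη0 ?_ (stable _ hr.1)
          (stable _ hr.2)).trans ?_
        · have : 0 < 64 * Real.pi / δ ^ 2 := by positivity
          linarith
        · rw [div_le_iff₀ (by positivity)]
          have h1 : 64 * Real.pi / δ ^ 2 ≤ η * 2 ^ k := by linarith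
          rw [div_le_iff₀ (by positivity)] at h1
          linarith
    have h1 := Set.ncard_le_ncard hsub (Set.toFinite _)
    have h2 := Set.ncard_add_ncard_compl B
    rw [Nat.card_fin] at h2
    have h3 : (R : ℝ) - 2 ≤ (Bᶜ.ncard : ℝ) := by
      have : R ≤ 2 + Bᶜ.ncard := by omega
      have : (R : ℝ) ≤ 2 + Bᶜ.ncard := by exact_mod_cast this
      linarith
    have h4 : (Bᶜ.ncard : ℝ) ≤ _ := Nat.cast_le.2 h1
    refine le_trans ?_ (h3.trans h4)
    linarith
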